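/- Let $r\ge 0$, let $|\cdot|$ be a norm on $\mathbb R^d$, and let $\mathcal C=C([-r,0],\mathbb R^d)$ with the norm $\|\psi\|=\sup_{\theta\in[-r,0]}|\psi(\theta)|$. Let $f:\mathbb R_+\times\mathcal C\to\mathbb R^d$ be continuous and quasi-bounded, i.e. bounded on bounded subsets of $\mathbb R_+\times\mathcal C$, and let $\phi\in\mathcal C$. Assume that at least one of the following holds: (a) $f$ is periodic in the first variable: there is $T>0$ with $f(t+T,\psi)=f(t,\psi)$ for all $t\ge 0$, $\psi\in\mathcal C$; (b) $f$ is a finite sum of continuous functions $\mathbb R_+\times\mathcal C\to\mathbb R^d$, each of which is periodic in the first variable (the periods may differ); (c) $f$ is almost periodic in the first variable, i.e. for every $\psi\in\mathcal C$ and $\eta>0$ there is $l>0$ such that every interval $[a,a+l]$, $a\ge 0$, contains a number $\tau$ with $|f(t+\tau,\psi)-f(t,\psi)|<\eta$ for all $t\ge 0$; and $f$ is continuous in the second variable uniformly with respect to the first, i.e. for every $\psi\in\mathcal C$ and $\eta>0$ there is $\rho>0$ such that $|f(t,\psi')-f(t,\psi)|<\eta$ for all $t\ge 0$ and all $\psi'\in\mathcal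 C$ with $\|\psi'-\psi\|<\rho$. Then for every $\psi\in\mathcal C$ the average $$F(\psi)=\lim_{T\to\infty}\frac1T\int_0^T f(t,\psi)\,dt$$ exists. Put $G(v)=F(\tilde v)$ for $v\in\mathbb R^d$, where $\tilde v\in\mathcal C$ is the constant function with value $v$. Suppose in addition that the averaged initial value problem $$\dot y(t)=G(y(t)),\qquad y(0)=\phi(0),$$ considered for $t\ge 0$, has a unique solution: a maximal solution exists, and any two solutions agree wherever both are defined. Let $y$ be the maximal solution, let $J$ be its interval of definition in $[0,\infty)$, and let $L\in J$. Then for every $\delta>0$ there exists $\varepsilon_0=\varepsilon_0(L,\delta)>0$ such that for all $\varepsilon\in(0,\varepsilon_0]$, every maximal (i.e. non-continuable) solution $x$ of $$\dot x(t)=f(t/\varepsilon,x_{t,\varepsilon})\quad (t\ge 0),\qquad x(t)=\phi(t/\varepsilon)\quad (t\in[-\varepsilon r,0]),$$ where $x_{t,\varepsilon}(\theta)=x(t+\varepsilon\theta)$ for $\theta\in[-r,0]$, is defined at least on $[-\varepsilon r,L]$ and satisfies $|x(t)-y(t)|<\delta$ for all $t\in[0,L]$. -/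

import Mathlib

open Filter Topology

noncomputable section

namespace DelayAveraging

/-- The Banach space of continuous functions `[-r, 0] → E` with the supremum norm.  Here `E` will be
a finite-dimensional real normed space, i.e. `ℝ^d` with an arbitrary norm. -/
abbrev History (r : ℝ) (E : Type*) [NormedAddCommGroup E] : Type _ :=
  C(Set.Icc (-r) 0, E)

section

variable {E : Type*} [NormedAddCommGroup E] {r : ℝ}

/-! ### Conditions on the vector field

A vector field `f : ℝ₊ × C([-r, 0], E) → E` is represented by a function `f : ℝ → History r E → E`
of which only the values at times `t ≥ 0` are ever used. -/

/-- Joint continuity of `f` on `ℝ₊ × C([-r, 0], E)`. -/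
def IsContinuousField (f : ℝ → History r E → E) : Prop :=
  ContinuousOn (fun p : ℝ × History r E => f p.1 p.2) (Set.Ici 0 ×ˢ Set.univ)

/-- `f` is periodic in time on `ℝ₊`, with a period that does not depend on the second variable. -/
def IsPeriodicInTime (f : ℝ → History r E → E) : Prop :=
  ∃ T : ℝ, 0 < T ∧ ∀ t : ℝ, 0 ≤ t → ∀ ψ : History r E, f (t + T) ψ = f t ψ

/-- `f` is a finite sum of continuous vector fields each of which is periodic in time; the periods
of the summands need not be commensurable. -/
def IsSumOfPeriodic (f : ℝ → History r E → E) : Prop :=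
  ∃ (n : ℕ) (g : Fin n → ℝ → History r E → E),
    (∀ i, IsContinuousField (g i) ∧ IsPeriodicInTime (g i)) ∧
      ∀ t : ℝ, 0 ≤ t → ∀ ψ : History r E, f t ψ = ∑ i, g i t ψ

/-- `f` is (Bohr) almost periodic in time on `ℝ₊`: for every fixed `ψ` and every `η > 0`, the
`η`-translation numbers of `f(·, ψ)` are relatively dense in `ℝ₊`. -/
def IsAlmostPeriodicInTime (f : ℝ → History r E → E) : Prop :=
  ∀ ψ : History r E, ∀ η : ℝ, 0 < η → ∃ l : ℝ, 0 < l ∧ ∀ a : ℝ, 0 ≤ a →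
    ∃ τ ∈ Set.Icc a (a + l), ∀ t : ℝ, 0 ≤ t → ‖f (t + τ) ψ - f t ψ‖ < η

/-- `f` is continuous in the second variable uniformly with respect to the first one. -/
def IsUniformlyContinuousInState (f : ℝ → History r E → E) : Prop :=
  ∀ ψ : History r E, ∀ η : ℝ, 0 < η → ∃ δ : ℝ, 0 < δ ∧ ∀ ψ' : History r E, ‖ψ' - ψ‖ < δ →
    ∀ t : ℝ, 0 ≤ t → ‖f t ψ' - f t ψ‖ < η

/-- `f` is quasi-bounded: it is bounded on bounded subsets of `ℝ₊ × C([-r, 0], E)`. -/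
def IsQuasiBounded (f : ℝ → History r E → E) : Prop :=
  ∀ B : Set (ℝ × History r E), B ⊆ Set.Ici 0 ×ˢ Set.univ → Bornology.IsBounded B →
    Bornology.IsBounded ((fun p : ℝ × History r E => f p.1 p.2) '' B)

/-- The element `x_{t,ε}` of `C([-r, 0], E)`, `x_{t,ε}(θ) = x(t + ε θ)`.  (The value is `0` if this
function of `θ` is not continuous, which does not occur where the definition is used.) -/
def delaySegment (r ε : ℝ) (x : ℝ → E) (t : ℝ) : History r E :=
  ContinuousMap.mkD (fun θ : Set.Icc (-r) 0 => x (t + ε * (θ : ℝ))) 0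

end

section

variable {E : Type*} [NormedAddCommGroup E] [NormedSpace ℝ E] {r : ℝ}

/-! ### Averages -/

/-- The mean `(1/T) ∫₀ᵀ f(t, ψ) dt`. -/
def timeMean (f : ℝ → History r E → E) (ψ : History r E) (T : ℝ) : E :=
  (1 / T) • ∫ t in (0 : ℝ)..T, f t ψ

/-- The average `F(ψ) = lim_{T → ∞} (1/T) ∫₀ᵀ f(t, ψ) dt`. -/
def average (f : ℝ → History r E → E) (ψ : History r E) : E :=
  limUnder atTop (timeMean f ψ)

/-- The averaged vector field `G(v) = F(ṽ)`, where `ṽ` is the constant function with value `v`. -/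
def averagedField (f : ℝ → History r E → E) (v : E) : E :=
  average f (ContinuousMap.const _ v)

/-! ### The averaged initial value problem `y' = G(y)`, `y(0) = v₀`, on `[0, ∞)` -/

/-- `y` is a solution of `y' = G(y)`, `y(0) = v₀` on the interval `J ⊆ [0, ∞)` containing `0`
(with one-sided derivatives at the end points of `J` that belong to `J`). -/
structure IsODESolution (G : E → E) (v₀ : E) (J : Set ℝ) (y : ℝ → E) : Prop where
  interval : J.OrdConnected
  zero_mem : (0 : ℝ) ∈ J
  nonneg : J ⊆ Set.Ici 0
  initial : y 0 = v₀
  deriv : ∀ t ∈ J, HasDerivWithinAt y (G (y t)) J t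

/-- `y`, defined on `J`, is a solution that cannot be continued to a larger interval. -/
def IsMaximalODESolution (G : E → E) (v₀ : E) (J : Set ℝ) (y : ℝ → E) : Prop :=
  IsODESolution G v₀ J y ∧
    ∀ (J' : Set ℝ) (y' : ℝ → E), IsODESolution G v₀ J' y' → J ⊆ J' → Set.EqOn y' y J → J' ⊆ J

/-- The initial value problem has a unique solution: there is a maximal solution, and any two
solutions agree wherever both are defined. -/
def HasUniqueODESolution (G : E → E) (v₀ : E) : Prop :=
  (∃ (J : Set ℝ) (y : ℝ → E), IsMaximalODESolution G v₀ J y) ∧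
    ∀ (J₁ J₂ : Set ℝ) (y₁ y₂ : ℝ → E), IsODESolution G v₀ J₁ y₁ → IsODESolution G v₀ J₂ y₂ →
      Set.EqOn y₁ y₂ (J₁ ∩ J₂)

/-! ### The delay problem `x'(t) = f(t/ε, x_{t,ε})` for `t ≥ 0`, `x(t) = φ(t/ε)` on `[-εr, 0]` -/

/-- `x` is a solution of the delay problem on the interval `I` with
`[-εr, 0] ⊆ I ⊆ [-εr, ∞)`.  The derivative is taken within `I ∩ [0, ∞)`: it is the right derivative
at `0`.  The initial condition is written with `t = ε θ`, `θ ∈ [-r, 0]`. -/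
structure IsDelaySolution (f : ℝ → History r E → E) (φ : History r E) (ε : ℝ)
    (I : Set ℝ) (x : ℝ → E) : Prop where
  interval : I.OrdConnected
  initial_subset : Set.Icc (-(ε * r)) 0 ⊆ I
  subset : I ⊆ Set.Ici (-(ε * r))
  continuousOn : ContinuousOn x I
  initial : ∀ θ : Set.Icc (-r) 0, x (ε * (θ : ℝ)) = φ θ
  deriv : ∀ t ∈ I, 0 ≤ t →
    HasDerivWithinAt x (f (t / ε) (delaySegment r ε x t)) (I ∩ Set.Ici 0) t

/-- `x`, defined on `I`, is a solution that cannot be continued to a larger interval. -/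
def IsMaximalDelaySolution (f : ℝ → History r E → E) (φ : History r E) (ε : ℝ)
    (I : Set ℝ) (x : ℝ → E) : Prop :=
  IsDelaySolution f φ ε I x ∧
    ∀ (I' : Set ℝ) (x' : ℝ → E), IsDelaySolution f φ ε I' x' → I ⊆ I' → Set.EqOn x' x I → I' ⊆ I

end

end DelayAveraging

end

open DelayAveraging

/-! All three alternatives yield the same three facts: `f` is continuous in the state uniformly in
time, each `f(·, ψ)` is bounded, and its mean exists (`averaging_hypotheses`). For a Bohr almost
periodic function, integrals over intervals of equal length `T` differ by at most `η T + C`, so the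
primitive is almost additive and the means are Cauchy.

The averaging statement is proved by contradiction and compactness. If it fails, there are `ε n → 0`
and maximal solutions `x n` violating it. Since a bounded maximal solution cannot live on a bounded
interval (`IsMaximalDelaySolution.not_bddAbove`, via a Peano theorem), each `x n` has a first time
`T n ≤ L` at distance exactly `δ` from `y`.

Up to `T n` the velocities are bounded uniformly in `n` (`IsDelaySolution.norm_velocity_le`).
Quasi-boundedness alone does not give this, because `t / ε` is unbounded. It serves only in the
initial layer `t ≤ ε r`; later the history is nearly constant, and near constant histories with
values in a compact set `f` is bounded for all times. Arzelà–Ascoli then gives limits `u₀` and `T₀`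
along an ultrafilter.

On a short time window the histories are close to the constant `u₀ s`, so the velocity is `f(t / ε,
u₀ s)` up to a small error, and its integral tends to the averaged field times the length. Hence
`u₀` solves the averaged equation on `[0, T₀)` (`hasDerivWithinAt_of_tendsto`). Uniqueness and
continuity give `u₀ T₀ = y T₀`, against the distance `δ`. -/

namespace DelayAveraging

/-! ### History segments and compactness of Lipschitz paths. -/

section Segments

variable {E : Type*} [NormedAddCommGroup E] {r : ℝ}

/-- The segment `θ ↦ u (s + ε θ)` of a path that is continuous on the whole line. -/
def segment (r ε s : ℝ) (u : C(ℝ, E)) : History r E :=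
  ⟨fun θ => u (s + ε * (θ : ℝ)), by fun_prop⟩

@[simp]
theorem segment_apply (ε s : ℝ) (u : C(ℝ, E)) (θ : Set.Icc (-r) 0) :
    segment r ε s u θ = u (s + ε * (θ : ℝ)) := rfl

/-- In the limit `ε = 0` the delay collapses; this is how constant histories enter the averaged
equation. -/
theorem segment_zero (s : ℝ) (u : C(ℝ, E)) :
    segment r 0 s u = ContinuousMap.const _ (u s) := by
  ext θ; simp

theorem continuous_segment :
    Continuous fun p : C(ℝ, E) × ℝ × ℝ => segment r p.2.1 p.2.2 p.1 := by
  refine ContinuousMap.continuous_of_continuous_uncurry _ ?_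
  simp only [Function.uncurry_def, segment_apply]
  fun_prop

theorem continuous_segment_time (ε : ℝ) (u : C(ℝ, E)) :
    Continuous fun s : ℝ => segment r ε s u :=
  continuous_segment.comp (by fun_prop : Continuous fun s : ℝ => (u, ε, s))

theorem segment_congr {ε s : ℝ} (hε : 0 ≤ ε) {u v : C(ℝ, E)}
    (h : ∀ t, s - ε * r ≤ t → t ≤ s → u t = v t) : segment r ε s u = segment r ε s v := by
  ext θ
  have h1 := θ.2.1
  have h2 := θ.2.2
  exact h _ (by nlinarith) (by nlinarith)

theorem delaySegment_eq_segment {ε s : ℝ} (hε : 0 ≤ ε) {x : ℝ → E} {u : C(ℝ, E)}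
    (h : ∀ t, s - ε * r ≤ t → t ≤ s → x t = u t) : delaySegment r ε x s = segment r ε s u := by
  have : (fun θ : Set.Icc (-r) 0 => x (s + ε * (θ : ℝ))) = ⇑(segment r ε s u) := by
    ext θ
    have h1 := θ.2.1
    have h2 := θ.2.2
    exact h _ (by nlinarith) (by nlinarith)
  rw [delaySegment, this, ContinuousMap.mkD_eq_self]

/-- By Arzelà–Ascoli, pointwise compactness suffices: the set is pointwise closed and lies in a
product of balls whose radii grow linearly away from `t₀`. -/
theorem isCompact_setOf_lipschitzWith [ProperSpace E] (M : NNReal) (t₀ R : ℝ) :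
    IsCompact {u : C(ℝ, E) | LipschitzWith M u ∧ ‖u t₀‖ ≤ R} := by
  refine ArzelaAscoli.isCompact_of_equicontinuous _ ?_ ?_
  · have himage : ContinuousMap.toFun '' {u : C(ℝ, E) | LipschitzWith M u ∧ ‖u t₀‖ ≤ R} =
        {g : ℝ → E | LipschitzWith M g ∧ ‖g t₀‖ ≤ R} := by
      ext g
      constructor
      · rintro ⟨u, hu, rfl⟩
        exact hu
      · rintro ⟨h1, h2⟩
        exact ⟨⟨g, h1.continuous⟩, ⟨h1, h2⟩, rfl⟩
    rw [himage]
    have hpi : IsCompact (Set.univ.pi fun t : ℝ =>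
        Metric.closedBall (0 : E) (R + M * |t - t₀|)) :=
      isCompact_univ_pi fun t => isCompact_closedBall _ _
    refine hpi.of_isClosed_subset ?_ ?_
    · refine IsClosed.inter (isClosed_setOfPred_lipschitzWith M) ?_
      exact isClosed_le (continuous_norm.comp (continuous_apply t₀)) continuous_const
    · rintro g ⟨h1, h2⟩ t -
      rw [mem_closedBall_zero_iff]
      have h3 := h1.dist_le_mul t t₀
      rw [dist_eq_norm, Real.dist_eq] at h3
      calc ‖g t‖ = ‖g t₀ + (g t - g t₀)‖ := by congr 1; abel
        _ ≤ _ := (norm_add_le _ _).trans (by linarith)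
  · exact (LipschitzWith.uniformEquicontinuous _ M fun u => u.2.1).equicontinuous

/-- Limits along an ultrafilter replace the extraction of subsequences. -/
theorem exists_tendsto_of_lipschitzWith [ProperSpace E] {ι : Type*} (𝒰 : Ultrafilter ι)
    {M : NNReal} {t₀ R : ℝ} {u : ι → C(ℝ, E)} (hu : ∀ᶠ n in (𝒰 : Filter ι), LipschitzWith M (u n))
    (hR : ∀ᶠ n in (𝒰 : Filter ι), ‖u n t₀‖ ≤ R) :
    ∃ v : C(ℝ, E), Tendsto u 𝒰 (𝓝 v) := by
  have h : ((𝒰.map u : Ultrafilter _) : Filter C(ℝ, E)) ≤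
      𝓟 {u : C(ℝ, E) | LipschitzWith M u ∧ ‖u t₀‖ ≤ R} := by
    rw [le_principal_iff]
    exact hu.and hR
  obtain ⟨v, -, hv⟩ := (isCompact_setOf_lipschitzWith M t₀ R).ultrafilter_le_nhds _ h
  exact ⟨v, hv⟩

end Segments

/-! ### Elementary calculus on intervals. -/

/-- The first time at which a continuous function reaches a given level. -/
theorem exists_first_time {g : ℝ → ℝ} {a b c : ℝ} (hg : ContinuousOn g (Set.Icc a b))
    (h0 : g a ≤ c) {t : ℝ} (ht : t ∈ Set.Icc a b) (hc : c ≤ g t) :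
    ∃ t₁ ∈ Set.Icc a b, g t₁ = c ∧ ∀ s ∈ Set.Ico a t₁, g s < c := by
  have hcl : IsCompact (Set.Icc a b ∩ g ⁻¹' Set.Ici c) :=
    isCompact_Icc.of_isClosed_subset (hg.preimage_isClosed_of_isClosed isClosed_Icc isClosed_Ici)
      Set.inter_subset_left
  obtain ⟨t₁, ⟨ht₁, hct₁⟩, hmin⟩ := hcl.exists_isLeast ⟨t, ht, hc⟩
  have hlt : ∀ s ∈ Set.Ico a t₁, g s < c := by
    intro s hs
    by_contra! hsc
    exact absurd (hmin ⟨⟨hs.1, hs.2.le.trans ht₁.2⟩, hsc⟩) (not_le.2 hs.2)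
  refine ⟨t₁, ht₁, le_antisymm ?_ hct₁, hlt⟩
  by_contra! hgt
  obtain ⟨s, hs, hsc⟩ := intermediate_value_Icc ht₁.1
    (hg.mono (Set.Icc_subset_Icc_right ht₁.2)) ⟨h0, hgt.le⟩
  rcases hs.2.eq_or_lt with rfl | h
  · exact hgt.ne hsc.symm
  · exact (hlt s ⟨hs.1, h⟩).ne hsc

theorem hasDerivWithinAt_Icc_union {E : Type*} [NormedAddCommGroup E] [NormedSpace ℝ E]
    {u v : ℝ → E} {a b c : ℝ}
    (h₁ : ∀ t ∈ Set.Icc a b, HasDerivWithinAt u (v t) (Set.Icc a b) t)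
    (h₂ : ∀ t ∈ Set.Icc b c, HasDerivWithinAt u (v t) (Set.Icc b c) t) :
    ∀ t ∈ Set.Icc a c, HasDerivWithinAt u (v t) (Set.Icc a c) t := by
  intro t ht
  rcases lt_trichotomy t b with h | rfl | h
  · refine (h₁ t ⟨ht.1, h.le⟩).mono_of_mem_nhdsWithin ?_
    filter_upwards [self_mem_nhdsWithin, mem_nhdsWithin_of_mem_nhds (Iio_mem_nhds h)] with s hs hs'
    exact ⟨hs.1, hs'.le⟩
  · have := (h₁ t ⟨ht.1, le_rfl⟩).union (h₂ t ⟨le_rfl, ht.2⟩)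
    rwa [Set.Icc_union_Icc_eq_Icc ht.1 ht.2] at this
  · refine (h₂ t ⟨h.le, ht.2⟩).mono_of_mem_nhdsWithin ?_
    filter_upwards [self_mem_nhdsWithin, mem_nhdsWithin_of_mem_nhds (Ioi_mem_nhds h)] with s hs hs'
    exact ⟨hs'.le, hs.2⟩

/-- A path has derivative `w` at `s` if its increments are close to those of `w` up to an
arbitrarily small relative error. -/
theorem hasDerivWithinAt_of_forall_norm_le {E : Type*} [NormedAddCommGroup E] [NormedSpace ℝ E]
    {u : ℝ → E} {w : E} {S : Set ℝ} {s : ℝ}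
    (h : ∀ η > 0, ∃ ρ > 0, ∀ t ∈ S, |t - s| < ρ → ‖u t - u s - (t - s) • w‖ ≤ η * |t - s|) :
    HasDerivWithinAt u w S s := by
  rw [hasDerivWithinAt_iff_isLittleO, Asymptotics.isLittleO_iff]
  intro η hη
  obtain ⟨ρ, hρ, H⟩ := h η hη
  filter_upwards [self_mem_nhdsWithin, mem_nhdsWithin_of_mem_nhds (Metric.ball_mem_nhds s hρ)]
    with t ht ht'
  exact H t ht ht'

end DelayAveraging

namespace DelayAveraging

/-! ### Means of almost periodic functions. -/

section Mean

variable {E : Type*} [NormedAddCommGroup E]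

/-- Bohr almost periodicity on `[0, ∞)`. -/
def IsAlmostPeriodic (g : ℝ → E) : Prop :=
  ∀ η : ℝ, 0 < η → ∃ l : ℝ, 0 < l ∧ ∀ a : ℝ, 0 ≤ a →
    ∃ τ ∈ Set.Icc a (a + l), ∀ t : ℝ, 0 ≤ t → ‖g (t + τ) - g t‖ < η

/-- A translation number in `[t - l, t]` carries `t` back into the compact interval `[0, l]`, at a
cost of at most `1`. -/
theorem IsAlmostPeriodic.exists_norm_le {g : ℝ → E} (h : IsAlmostPeriodic g)
    (hg : ContinuousOn g (Set.Ici 0)) : ∃ M, 0 ≤ M ∧ ∀ t, 0 ≤ t → ‖g t‖ ≤ M := by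
  obtain ⟨l, hl, H⟩ := h 1 one_pos
  obtain ⟨M, hM⟩ := (isCompact_Icc (a := (0 : ℝ)) (b := l)).exists_bound_of_continuousOn
    (hg.mono fun t ht => ht.1)
  have hM0 : 0 ≤ M := (norm_nonneg _).trans (hM 0 ⟨le_rfl, hl.le⟩)
  refine ⟨M + 1, by linarith, fun t ht => ?_⟩
  rcases le_total t l with htl | htl
  · linarith [hM t ⟨ht, htl⟩]
  · obtain ⟨τ, hτ, Hτ⟩ := H (t - l) (by linarith)
    have h1 := Hτ (t - τ) (by linarith [hτ.2])
    have h2 := hM (t - τ) ⟨by linarith [hτ.2], by linarith [hτ.1]⟩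
    rw [sub_add_cancel] at h1
    have h3 := norm_le_norm_add_norm_sub' (g t) (g (t - τ))
    linarith

theorem intervalIntegrable_of_continuousOn_Ici {g : ℝ → E} (hg : ContinuousOn g (Set.Ici 0))
    {a b : ℝ} (ha : 0 ≤ a) (hb : 0 ≤ b) : IntervalIntegrable g MeasureTheory.volume a b :=
  (hg.mono fun _ ht => (le_min ha hb).trans ht.1).intervalIntegrable

variable [NormedSpace ℝ E]

theorem norm_integral_le_of_nonneg {g : ℝ → E} {M : ℝ} (hM : ∀ t, 0 ≤ t → ‖g t‖ ≤ M)
    {a b : ℝ} (ha : 0 ≤ a) (hb : 0 ≤ b) : ‖∫ t in a..b, g t‖ ≤ M * |b - a| :=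
  intervalIntegral.norm_integral_le_of_norm_le_const fun t ht =>
    hM t ((le_min ha hb).trans ht.1.le)

/-- Move `[a, a + T]` to `[τ, T + τ]` with a translation number `τ ∈ [a, a + l]`: the two end pieces
cost at most `M l` each, and the shift costs `η T`. -/
theorem IsAlmostPeriodic.norm_integral_sub_le {g : ℝ → E} (h : IsAlmostPeriodic g)
    (hg : ContinuousOn g (Set.Ici 0)) {η : ℝ} (hη : 0 < η) :
    ∃ C, 0 ≤ C ∧ ∀ a T : ℝ, 0 ≤ a → 0 ≤ T →
      ‖(∫ t in a..(a + T), g t) - ∫ t in (0 : ℝ)..T, g t‖ ≤ η * T + C := by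
  obtain ⟨M, hM0, hM⟩ := h.exists_norm_le hg
  obtain ⟨l, hl, H⟩ := h η hη
  refine ⟨2 * (M * l), by positivity, fun a T ha hT => ?_⟩
  obtain ⟨τ, hτ, Hτ⟩ := H a ha
  have hτ0 : 0 ≤ τ := ha.trans hτ.1
  have hi := fun {x y : ℝ} (hx : 0 ≤ x) (hy : 0 ≤ y) =>
    intervalIntegrable_of_continuousOn_Ici hg hx hy
  have e1 : ∫ t in a..(a + T), g t = (∫ t in a..τ, g t) + (∫ t in τ..(T + τ), g t) +
      ∫ t in (T + τ)..(a + T), g t := by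
    rw [intervalIntegral.integral_add_adjacent_intervals,
      intervalIntegral.integral_add_adjacent_intervals] <;> exact hi (by linarith) (by linarith)
  have e2 : ∫ t in τ..(T + τ), g t = ∫ t in (0 : ℝ)..T, g (t + τ) := by
    rw [intervalIntegral.integral_comp_add_right, zero_add]
  have e3 : (∫ t in (0 : ℝ)..T, g (t + τ)) - ∫ t in (0 : ℝ)..T, g t =
      ∫ t in (0 : ℝ)..T, (g (t + τ) - g t) := by
    rw [intervalIntegral.integral_sub]
    · have := (hi (x := 0 + τ) (y := T + τ) (by linarith) (by linarith)).comp_add_right τ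
      simpa using this
    · exact hi le_rfl hT
  have b1 : ‖∫ t in a..τ, g t‖ ≤ M * l := by
    refine (norm_integral_le_of_nonneg hM ha hτ0).trans ?_
    gcongr
    rw [abs_le]; constructor <;> linarith [hτ.1, hτ.2]
  have b2 : ‖∫ t in (T + τ)..(a + T), g t‖ ≤ M * l := by
    refine (norm_integral_le_of_nonneg hM (by linarith) (by linarith)).trans ?_
    gcongr
    rw [abs_le]; constructor <;> linarith [hτ.1, hτ.2]
  have b3 : ‖∫ t in (0 : ℝ)..T, (g (t + τ) - g t)‖ ≤ η * T := by
    refine (intervalIntegral.norm_integral_le_of_norm_le_const (C := η) fun t ht => ?_).trans ?_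
    · rw [Set.uIoc_of_le hT] at ht
      exact (Hτ t ht.1.le).le
    · rw [sub_zero, abs_of_nonneg hT]
  have e4 : (∫ t in a..(a + T), g t) - ∫ t in (0 : ℝ)..T, g t = (∫ t in a..τ, g t) +
      (∫ t in (T + τ)..(a + T), g t) + ∫ t in (0 : ℝ)..T, (g (t + τ) - g t) := by
    rw [e1, e2, ← e3]; abel
  rw [e4]
  exact (norm_add₃_le).trans (by linarith)

/-- The primitive `Φ` is additive up to `η T + C`. For one block length `T` with `C ≤ η T`, cutting
`[0, S]` into blocks shows that every late mean is within `3 η` of the mean over `[0, T]`. -/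
theorem IsAlmostPeriodic.exists_tendsto_mean [CompleteSpace E] {g : ℝ → E}
    (h : IsAlmostPeriodic g) (hg : ContinuousOn g (Set.Ici 0)) :
    ∃ m : E, Tendsto (fun T : ℝ => (1 / T) • ∫ t in (0 : ℝ)..T, g t) atTop (𝓝 m) := by
  obtain ⟨M, hM0, hM⟩ := h.exists_norm_le hg
  rw [← cauchy_map_iff_exists_tendsto]
  refine Metric.cauchy_iff.2 ⟨inferInstance, fun κ hκ => ?_⟩
  set η := κ / 10 with hη
  have hη0 : 0 < η := by positivity
  obtain ⟨C, hC0, hC⟩ := h.norm_integral_sub_le hg hη0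
  set Φ : ℝ → E := fun T => ∫ t in (0 : ℝ)..T, g t with hΦ
  have hΦM : ∀ T, 0 ≤ T → ‖Φ T‖ ≤ M * T := fun T hT => by
    simpa [abs_of_nonneg hT] using norm_integral_le_of_nonneg hM le_rfl hT
  have hadd : ∀ a T, 0 ≤ a → 0 ≤ T → ‖Φ (a + T) - Φ a - Φ T‖ ≤ η * T + C := by
    intro a T ha hT
    have : Φ (a + T) - Φ a = ∫ t in a..(a + T), g t :=
      intervalIntegral.integral_interval_sub_left
        (intervalIntegrable_of_continuousOn_Ici hg le_rfl (by linarith))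
        (intervalIntegrable_of_continuousOn_Ici hg le_rfl ha)
    rw [this]
    exact hC a T ha hT
  set T := C / η + 1 with hT
  have hT0 : 0 < T := by positivity
  have hCT : C ≤ η * T := by
    rw [hT, mul_add, mul_div_cancel₀ _ hη0.ne']; linarith
  have hmul : ∀ n : ℕ, ∀ q, 0 ≤ q →
      ‖Φ (n * T + q) - (n : ℝ) • Φ T‖ ≤ n * (2 * η * T) + M * q := by
    intro n q hq
    induction n with
    | zero => simpa using hΦM q hq
    | succ n ih =>
      have h1 := hadd (n * T + q) T (by positivity) hT0.le
      have e : Φ ((n + 1 : ℕ) * T + q) - ((n + 1 : ℕ) : ℝ) • Φ T =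
          (Φ (n * T + q + T) - Φ (n * T + q) - Φ T) + (Φ (n * T + q) - (n : ℝ) • Φ T) := by
        have : ((n + 1 : ℕ) : ℝ) * T + q = n * T + q + T := by push_cast; ring
        rw [this, Nat.cast_succ, add_smul, one_smul]; abel
      rw [e]
      refine (norm_add_le _ _).trans ?_
      push_cast
      linarith
  -- Beyond `S₀`, the incomplete block and the rounding of `S / T`, each costing at most `M T`,
  -- together contribute at most `η S`.
  set S₀ := (2 * M * T) / η + 1 with hS₀
  have hS₀0 : 0 < S₀ := by positivity
  have hclose : ∀ S, S₀ ≤ S → dist ((1 / S) • Φ S) ((1 / T) • Φ T) ≤ 3 * η := by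
    intro S hS
    have hS0 : 0 < S := hS₀0.trans_le hS
    set n := ⌊S / T⌋₊
    have hn1 : (n : ℝ) * T ≤ S := by
      have := Nat.floor_le (a := S / T) (by positivity)
      rwa [le_div_iff₀ hT0] at this
    have hn2 : S ≤ n * T + T := by
      have := (Nat.lt_floor_add_one (S / T)).le
      rw [div_le_iff₀ hT0] at this
      linarith
    have h1 := hmul n (S - n * T) (by linarith)
    rw [add_sub_cancel] at h1
    have h2 : ‖((n : ℝ) - S / T) • Φ T‖ ≤ M * T := by
      rw [norm_smul, Real.norm_eq_abs]
      have : |(n : ℝ) - S / T| ≤ 1 := by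
        have e : (n : ℝ) - S / T = (n * T - S) / T := by field_simp
        rw [e, abs_div, abs_of_pos hT0, div_le_one hT0, abs_le]
        constructor <;> linarith
      calc _ ≤ 1 * (M * T) := mul_le_mul this (hΦM T hT0.le) (norm_nonneg _) zero_le_one
        _ = _ := one_mul _
    have e : (1 / S) • Φ S - (1 / T) • Φ T =
        (1 / S) • ((Φ S - (n : ℝ) • Φ T) + ((n : ℝ) - S / T) • Φ T) := by
      have : (1 / T) • Φ T = (1 / S) • (S / T) • Φ T := by
        rw [smul_smul]; congr 1; field_simp
      rw [this, sub_smul, ← smul_sub]; congr 1; abel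
    have hMT : 2 * M * T ≤ η * S := by
      have : 2 * M * T / η ≤ S := by linarith
      rw [div_le_iff₀ hη0] at this
      linarith
    rw [dist_eq_norm, e, norm_smul, Real.norm_eq_abs, abs_of_pos (by positivity), one_div,
      inv_mul_le_iff₀ hS0]
    refine (norm_add_le _ _).trans ?_
    have h3 : M * (S - n * T) ≤ M * T := by gcongr; linarith
    have h4 : (n : ℝ) * (2 * η * T) ≤ 2 * η * S := by nlinarith
    linarith
  refine ⟨_, image_mem_map (Ici_mem_atTop S₀), ?_⟩
  rintro _ ⟨S, hS, rfl⟩ _ ⟨S', hS', rfl⟩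
  calc _ ≤ _ := dist_triangle_right _ _ ((1 / T) • Φ T)
    _ ≤ 3 * η + 3 * η := add_le_add (hclose S hS) (hclose S' hS')
    _ < κ := by linarith

end Mean

/-! ### Consequences of the alternative hypotheses on the field. -/

section Fields

variable {E : Type*} [NormedAddCommGroup E] {r : ℝ} {f : ℝ → History r E → E}

theorem IsContinuousField.continuousOn_time (hf : IsContinuousField f) (ψ : History r E) :
    ContinuousOn (fun t => f t ψ) (Set.Ici 0) :=
  ContinuousOn.comp (g := fun p : ℝ × History r E => f p.1 p.2) (f := fun t => (t, ψ)) hf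
    (by fun_prop) fun _ ht => ⟨ht, trivial⟩

theorem apply_add_nat_mul {T : ℝ} (hT : 0 < T)
    (h : ∀ t : ℝ, 0 ≤ t → ∀ ψ : History r E, f (t + T) ψ = f t ψ) (k : ℕ) {t : ℝ} (ht : 0 ≤ t)
    (ψ : History r E) : f (t + k * T) ψ = f t ψ := by
  induction k with
  | zero => simp
  | succ k ih =>
    rw [← ih, ← h (t + k * T) (by positivity)]
    congr 1; push_cast; ring

theorem IsPeriodicInTime.isAlmostPeriodic (h : IsPeriodicInTime f) (ψ : History r E) :
    IsAlmostPeriodic fun t => f t ψ := by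
  obtain ⟨T, hT, H⟩ := h
  refine fun η hη => ⟨T, hT, fun a ha => ⟨⌈a / T⌉₊ * T, ⟨?_, ?_⟩, fun t ht => ?_⟩⟩
  · rw [← div_le_iff₀ hT]
    exact Nat.le_ceil _
  · have := (Nat.ceil_lt_add_one (a := a / T) (by positivity)).le
    calc _ ≤ (a / T + 1) * T := by gcongr
      _ = a + T := by field_simp
  · simpa only [apply_add_nat_mul hT H _ ht, sub_self, norm_zero] using hη

/-- Joint continuity gives a radius near each time; compactness of one period makes it uniform, and
periodicity carries it to all times. -/
theorem IsPeriodicInTime.isUniformlyContinuousInState (h : IsPeriodicInTime f)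
    (hf : IsContinuousField f) : IsUniformlyContinuousInState f := by
  obtain ⟨T, hT, H⟩ := h
  intro ψ η hη
  have hloc : ∀ t ∈ Set.Icc (0 : ℝ) T, ∀ᶠ q : ℝ × History r E in 𝓝 t ×ˢ 𝓝 ψ,
      0 ≤ q.1 → ‖f q.1 q.2 - f q.1 ψ‖ < η := by
    intro t ht
    have h1 : ContinuousWithinAt (fun p : ℝ × History r E => f p.1 p.2 - f p.1 ψ)
        (Set.Ici 0 ×ˢ Set.univ) (t, ψ) := by
      refine (hf (t, ψ) ⟨ht.1, trivial⟩).sub ?_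
      exact ((hf.continuousOn_time ψ).comp continuousOn_fst fun p hp => hp.1) (t, ψ)
        ⟨ht.1, trivial⟩
    have h2 := h1.norm.eventually_lt_const (by simpa using hη : _ < η)
    rw [eventually_nhdsWithin_iff, nhds_prod_eq] at h2
    filter_upwards [h2] with q hq hq0
    exact hq ⟨hq0, trivial⟩
  have hev := (isCompact_Icc (a := (0 : ℝ)) (b := T)).eventually_forall_of_forall_eventually
    (x₀ := ψ) (P := fun ψ' t => 0 ≤ t → ‖f t ψ' - f t ψ‖ < η) (fun t ht => by
      rw [nhds_prod_eq, Filter.eventually_swap_iff]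
      exact hloc t ht)
  obtain ⟨ρ, hρ, hball⟩ := Metric.eventually_nhds_iff.1 hev
  refine ⟨ρ, hρ, fun ψ' hψ' t ht => ?_⟩
  have hk : (⌊t / T⌋₊ : ℝ) * T ≤ t := by
    rw [← le_div_iff₀ hT]
    exact Nat.floor_le (by positivity)
  have hk' : t ≤ ⌊t / T⌋₊ * T + T := by
    have := (Nat.lt_floor_add_one (t / T)).le
    rw [div_le_iff₀ hT] at this
    linarith
  have e : ∀ χ, f t χ = f (t - ⌊t / T⌋₊ * T) χ := fun χ => by
    simpa using apply_add_nat_mul hT H ⌊t / T⌋₊ (t := t - ⌊t / T⌋₊ * T) (by linarith) χ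
  rw [e ψ', e ψ]
  exact hball (by rwa [dist_eq_norm]) _ ⟨by linarith, by linarith⟩ (by linarith)

theorem isUniformlyContinuousInState_sum {n : ℕ} {g : Fin n → ℝ → History r E → E}
    (hg : ∀ i, IsUniformlyContinuousInState (g i))
    (h : ∀ t : ℝ, 0 ≤ t → ∀ ψ : History r E, f t ψ = ∑ i, g i t ψ) :
    IsUniformlyContinuousInState f := by
  intro ψ η hη
  -- Dividing by `n + 1` instead of `n` covers the empty sum and keeps the final inequality strict.
  have hη' : 0 < η / (n + 1) := by positivity
  choose ρ hρ H using fun i => hg i ψ (η / (n + 1)) hη'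
  have hev : ∀ᶠ s : ℝ in 𝓝[>] 0, ∀ i, s ≤ ρ i := by
    rw [eventually_all]
    intro i
    filter_upwards [mem_nhdsWithin_of_mem_nhds (Iio_mem_nhds (hρ i))] with s hs using hs.le
  obtain ⟨s, hs, hs0⟩ := (hev.and self_mem_nhdsWithin).exists
  refine ⟨s, hs0, fun ψ' hψ' t ht => ?_⟩
  rw [h t ht, h t ht, ← Finset.sum_sub_distrib]
  calc _ ≤ ∑ i, ‖g i t ψ' - g i t ψ‖ := norm_sum_le _ _
    _ ≤ ∑ _i : Fin n, η / (n + 1) :=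
      Finset.sum_le_sum fun i _ => (H i ψ' (hψ'.trans_le (hs i)) t ht).le
    _ = n * (η / (n + 1)) := by simp
    _ < η := by
      rw [mul_div_assoc', div_lt_iff₀ (by positivity)]
      linarith

variable [NormedSpace ℝ E]

/-- The consequences of the three alternative hypotheses of the averaging theorem. -/
theorem averaging_hypotheses [CompleteSpace E] (hf : IsContinuousField f)
    (hcase : IsPeriodicInTime f ∨ IsSumOfPeriodic f ∨
      (IsAlmostPeriodicInTime f ∧ IsUniformlyContinuousInState f)) :
    IsUniformlyContinuousInState f ∧
      (∀ ψ, ∃ M, 0 ≤ M ∧ ∀ t, 0 ≤ t → ‖f t ψ‖ ≤ M) ∧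
      ∀ ψ, ∃ m, Tendsto (timeMean f ψ) atTop (𝓝 m) := by
  have hsum : IsSumOfPeriodic f ∨ (IsAlmostPeriodicInTime f ∧ IsUniformlyContinuousInState f) := by
    rcases hcase with h | h
    · exact .inl ⟨1, fun _ => f, fun _ => ⟨hf, h⟩, fun t _ ψ => by simp⟩
    · exact h
  rcases hsum with ⟨n, g, hg, hfg⟩ | ⟨hap, huc⟩
  · refine ⟨isUniformlyContinuousInState_sum
      (fun i => (hg i).2.isUniformlyContinuousInState (hg i).1) hfg, fun ψ => ?_, fun ψ => ?_⟩
    · choose M hM0 hM using fun i =>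
        ((hg i).2.isAlmostPeriodic ψ).exists_norm_le ((hg i).1.continuousOn_time ψ)
      refine ⟨∑ i, M i, Finset.sum_nonneg fun i _ => hM0 i, fun t ht => ?_⟩
      rw [hfg t ht]
      exact norm_sum_le_of_le _ fun i _ => hM i t ht
    · choose m hm using fun i =>
        ((hg i).2.isAlmostPeriodic ψ).exists_tendsto_mean ((hg i).1.continuousOn_time ψ)
      refine ⟨∑ i, m i, (tendsto_finsetSum _ fun i _ => hm i).congr' ?_⟩
      filter_upwards [eventually_ge_atTop 0] with T hT
      rw [timeMean, ← Finset.smul_sum, ← intervalIntegral.integral_finsetSum fun i _ =>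
        intervalIntegrable_of_continuousOn_Ici ((hg i).1.continuousOn_time ψ) le_rfl hT]
      congr 1
      refine intervalIntegral.integral_congr fun t ht => ?_
      rw [Set.uIcc_of_le hT] at ht
      exact (hfg t ht.1 ψ).symm
  · have h : ∀ ψ, IsAlmostPeriodic fun t => f t ψ := hap
    exact ⟨huc, fun ψ => (h ψ).exists_norm_le (hf.continuousOn_time ψ),
      fun ψ => (h ψ).exists_tendsto_mean (hf.continuousOn_time ψ)⟩

end Fields

end DelayAveraging

namespace DelayAveraging

/-! ### Peano's theorem by Tonelli's scheme. -/

section Peano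

variable {E : Type*} [NormedAddCommGroup E] {r : ℝ}

theorem continuous_comp_segment (F : C(ℝ × History r E, E)) (ε τ : ℝ) (u : C(ℝ, E)) :
    Continuous fun s => F (s, segment r ε (s - τ) u) := by
  have := (continuous_segment_time (r := r) ε u).comp (continuous_id.sub continuous_const :
    Continuous fun s => s - τ)
  exact F.continuous.comp (continuous_id.prodMk this)

variable [NormedSpace ℝ E]

/-- One step of Tonelli's approximation scheme: the delay is increased by `τ`. -/
noncomputable def tonelliStep (F : C(ℝ × History r E, E)) (ε β τ : ℝ) (z u : C(ℝ, E)) : C(ℝ, E) :=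
  ⟨fun t => z (min t β) + ∫ s in β..max t β, F (s, segment r ε (s - τ) u), by
    have := intervalIntegral.continuous_primitive
      (μ := MeasureTheory.volume)
      (fun a b => (continuous_comp_segment F ε τ u).intervalIntegrable a b) β
    exact (z.continuous.comp (by fun_prop)).add (this.comp (by fun_prop))⟩

theorem tonelliStep_apply (F : C(ℝ × History r E, E)) (ε β τ : ℝ) (z u : C(ℝ, E)) (t : ℝ) :
    tonelliStep F ε β τ z u t =
      z (min t β) + ∫ s in β..max t β, F (s, segment r ε (s - τ) u) := rfl

theorem tonelliStep_of_le {F : C(ℝ × History r E, E)} {ε β τ : ℝ} {z u : C(ℝ, E)} {t : ℝ}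
    (ht : t ≤ β) : tonelliStep F ε β τ z u t = z t := by
  simp [tonelliStep, ht]

/-- Up to time `t` the integrand sees the path only up to `t - τ`, so each iteration settles a
further stretch of length `τ`. -/
theorem tonelliStep_iterate {F : C(ℝ × History r E, E)} {ε β τ : ℝ} (hε : 0 ≤ ε) (hτ : 0 ≤ τ)
    {z : C(ℝ, E)} (k : ℕ) {t : ℝ} (ht : t ≤ β + k * τ) :
    (tonelliStep F ε β τ z)^[k + 1] z t = (tonelliStep F ε β τ z)^[k] z t := by
  induction k generalizing t with
  | zero => simpa using tonelliStep_of_le (by simpa using ht)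
  | succ k ih =>
    rw [Function.iterate_succ_apply' _ (k + 1)]
    conv_rhs => rw [Function.iterate_succ_apply']
    rw [tonelliStep_apply, tonelliStep_apply]
    congr 1
    refine intervalIntegral.integral_congr fun s hs => ?_
    rw [Set.uIcc_of_le (le_max_right _ _)] at hs
    have hs' : s ≤ β + (k + 1 : ℕ) * τ := hs.2.trans (max_le ht (by
      have : 0 ≤ ((k + 1 : ℕ) : ℝ) * τ := by positivity
      linarith))
    have : segment r ε (s - τ) ((tonelliStep F ε β τ z)^[k + 1] z) =
        segment r ε (s - τ) ((tonelliStep F ε β τ z)^[k] z) := by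
      refine segment_congr hε fun t' _ ht' => ih ?_
      push_cast at hs'
      linarith
    exact congrArg (fun ψ => F (s, ψ)) this

/-- Peano's existence theorem for a delay equation with continuous, bounded right-hand side. -/
theorem exists_delay_solution [FiniteDimensional ℝ E] (F : C(ℝ × History r E, E)) {M : ℝ}
    (hM : ∀ p, ‖F p‖ ≤ M) {ε : ℝ} (hε : 0 ≤ ε) (β : ℝ) (z : C(ℝ, E)) :
    ∃ u : C(ℝ, E), (∀ t ≤ β, u t = z t) ∧ ∀ t ∈ Set.Icc β (β + 1),
      HasDerivWithinAt u (F (t, segment r ε t u)) (Set.Icc β (β + 1)) t := by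
  have : ProperSpace E := FiniteDimensional.proper ℝ E
  have hM0 : 0 ≤ M := (norm_nonneg _).trans (hM (0, 0))
  set τ : ℕ → ℝ := fun n => 1 / ((n : ℝ) + 1) with hτ
  have hτ0 : ∀ n, 0 < τ n := fun n => by positivity
  -- Since `(n + 1) τ n = 1`, this many iterations reach a fixed point on `(-∞, β + 1]`.
  set u' : ℕ → C(ℝ, E) := fun n => (tonelliStep F ε β (τ n) z)^[n + 1] z with hu'
  set u : ℕ → C(ℝ, E) := fun n => tonelliStep F ε β (τ n) z (u' n) with hu
  have huu' : ∀ n, ∀ t ≤ β + 1, u n t = u' n t := by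
    intro n t ht
    have := tonelliStep_iterate (F := F) hε (hτ0 n).le (z := z) (n + 1) (t := t) (β := β) (by
      have h1 : ((n + 1 : ℕ) : ℝ) * τ n = 1 := by
        rw [hτ]; push_cast; field_simp
      rw [h1]; exact ht)
    rwa [Function.iterate_succ_apply'] at this
  -- The given past `z` need not be Lipschitz; subtracting it, frozen after `β`, leaves
  -- equi-Lipschitz paths.
  set zβ : C(ℝ, E) := ⟨fun t => z (min t β), z.continuous.comp (by fun_prop)⟩ with hzβ
  have hint : ∀ n a b, IntervalIntegrable (fun s => F (s, segment r ε (s - τ n) (u' n)))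
      MeasureTheory.volume a b := fun n a b =>
    (continuous_comp_segment F ε (τ n) (u' n)).intervalIntegrable a b
  have hdiff : ∀ n a b, (u n - zβ) b - (u n - zβ) a =
      ∫ s in (max a β)..(max b β), F (s, segment r ε (s - τ n) (u' n)) := by
    intro n a b
    simp only [hu, hzβ, tonelliStep, ContinuousMap.sub_apply, ContinuousMap.coe_mk,
      add_sub_cancel_left]
    exact intervalIntegral.integral_interval_sub_left (hint n _ _) (hint n _ _)
  have hlip : ∀ n, LipschitzWith M.toNNReal (u n - zβ) := by
    intro n
    refine LipschitzWith.of_dist_le_mul fun a b => ?_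
    rw [dist_eq_norm, hdiff, Real.coe_toNNReal _ hM0, Real.dist_eq]
    refine (intervalIntegral.norm_integral_le_of_norm_le_const fun s _ => hM _).trans ?_
    exact mul_le_mul_of_nonneg_left (abs_max_sub_max_le_abs a b β) hM0
  set 𝒰 : Ultrafilter ℕ := hyperfilter ℕ
  obtain ⟨w, hw⟩ := exists_tendsto_of_lipschitzWith 𝒰 (t₀ := β) (R := 0)
    (Eventually.of_forall hlip) (Eventually.of_forall fun n => by simp [hu, hzβ, tonelliStep])
  have hlim : Tendsto u 𝒰 (𝓝 (w + zβ)) := by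
    simpa using hw.add_const zβ
  have hpt : ∀ t, Tendsto (fun n => u n t) 𝒰 (𝓝 ((w + zβ) t)) := fun t =>
    ((continuous_eval_const t).tendsto (w + zβ)).comp hlim
  have hτlim : Tendsto τ 𝒰 (𝓝 0) :=
    tendsto_one_div_add_atTop_nhds_zero_nat.mono_left Nat.hyperfilter_le_atTop
  refine ⟨w + zβ, fun t ht => ?_, fun s hs => ?_⟩
  · refine tendsto_nhds_unique (hpt t) ?_
    exact tendsto_const_nhds.congr fun n => (tonelliStep_of_le ht).symm
  · refine hasDerivWithinAt_of_forall_norm_le fun η hη => ?_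
    set v := F (s, segment r ε s (w + zβ)) with hv
    have hF : Tendsto (fun q : ℕ × ℝ => F (q.2, segment r ε (q.2 - τ q.1) (u q.1)))
        ((𝒰 : Filter ℕ) ×ˢ 𝓝 s) (𝓝 v) := by
      refine (F.continuous.tendsto _).comp (tendsto_snd.prodMk_nhds ?_)
      have h1 : Tendsto (fun q : ℕ × ℝ => (u q.1, ε, q.2 - τ q.1)) ((𝒰 : Filter ℕ) ×ˢ 𝓝 s)
          (𝓝 (w + zβ, ε, s)) := by
        refine (hlim.comp tendsto_fst).prodMk_nhds (tendsto_const_nhds.prodMk_nhds ?_)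
        simpa using tendsto_snd.sub (hτlim.comp tendsto_fst)
      exact (continuous_segment.tendsto _).comp h1
    obtain ⟨p, hp, p', hp', H⟩ := eventually_prod_iff.1
      (hF.eventually (Metric.closedBall_mem_nhds v hη))
    obtain ⟨ρ, hρ, hρ'⟩ := Metric.eventually_nhds_iff.1 hp'
    refine ⟨ρ, hρ, fun t ht hts => ?_⟩
    refine le_of_tendsto (((hpt t).sub (hpt s)).sub_const _).norm ?_
    filter_upwards [hp] with n hn
    have e : u n t - u n s = ∫ σ in s..t, F (σ, segment r ε (σ - τ n) (u' n)) := by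
      have := hdiff n s t
      rw [max_eq_left hs.1, max_eq_left ht.1] at this
      rw [← this]
      simp [hzβ, hs.1, ht.1]
    have e2 : (t - s) • v = ∫ _σ in s..t, v := by simp
    rw [e, e2, ← intervalIntegral.integral_sub (hint n _ _) (by simp)]
    refine intervalIntegral.norm_integral_le_of_norm_le_const fun σ hσ => ?_
    have hσ' := Set.uIoc_subset_uIcc hσ
    have hseg : segment r ε (σ - τ n) (u' n) = segment r ε (σ - τ n) (u n) := by
      refine segment_congr hε fun t' _ ht' => (huu' n t' ?_).symm
      have : σ ≤ β + 1 := hσ'.2.trans (max_le hs.2 ht.2)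
      linarith [hτ0 n]
    rw [hseg, ← dist_eq_norm]
    refine H hn (hρ' ?_)
    have := Set.abs_sub_left_of_mem_uIcc hσ'
    rw [Real.dist_eq]
    linarith
end Peano

end DelayAveraging

namespace DelayAveraging

/-! ### Continuation of bounded solutions. -/

section Continuation

variable {E : Type*} [NormedAddCommGroup E] {r : ℝ} {f : ℝ → History r E → E}

/-- The rescaled vector field `(s, ψ) ↦ f (s / ε) ψ`, extended to negative times. -/
noncomputable def rescaledField (hf : IsContinuousField f) (ε : ℝ) (hε : 0 ≤ ε) : C(ℝ × History r E, E) :=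
  ⟨fun p => f (max p.1 0 / ε) p.2, hf.comp_continuous (f := fun p : ℝ × History r E =>
    (max p.1 0 / ε, p.2)) (by fun_prop) fun p => ⟨div_nonneg (le_max_right _ _) hε, trivial⟩⟩

theorem rescaledField_apply (hf : IsContinuousField f) {ε : ℝ} (hε : 0 ≤ ε) {s : ℝ} (hs : 0 ≤ s)
    (ψ : History r E) : rescaledField hf ε hε (s, ψ) = f (s / ε) ψ := by
  simp [rescaledField, hs]

/-- No continuity is needed: the default value `0` of `delaySegment` obeys the bound as well. -/
theorem norm_delaySegment_le {ε R s : ℝ} (hε : 0 ≤ ε) (hR : 0 ≤ R) {x : ℝ → E}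
    (h : ∀ t, s - ε * r ≤ t → t ≤ s → ‖x t‖ ≤ R) : ‖delaySegment r ε x s‖ ≤ R := by
  rw [ContinuousMap.norm_le _ hR]
  intro θ
  have h1 := θ.2.1
  have h2 := θ.2.2
  by_cases hc : Continuous fun θ : Set.Icc (-r) 0 => x (s + ε * (θ : ℝ))
  · rw [delaySegment, ContinuousMap.mkD_apply_of_continuous hc]
    exact h _ (by nlinarith) (by nlinarith)
  · rw [delaySegment, ContinuousMap.mkD_of_not_continuous hc]
    simpa using hR

theorem IsQuasiBounded.exists_norm_le (hqb : IsQuasiBounded f) (T R : ℝ) :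
    ∃ M, 0 ≤ M ∧ ∀ t, 0 ≤ t → t ≤ T → ∀ ψ, ‖ψ‖ ≤ R → ‖f t ψ‖ ≤ M := by
  have h := hqb (Set.Icc 0 T ×ˢ Metric.closedBall 0 R)
    (Set.prod_mono (fun t ht => ht.1) (Set.subset_univ _))
    ((Metric.isBounded_Icc 0 T).prod Metric.isBounded_closedBall)
  obtain ⟨M, hM⟩ := h.exists_norm_le
  refine ⟨max M 0, le_max_right _ _, fun t h0 hT ψ hψ => (hM _ ?_).trans (le_max_left _ _)⟩
  exact ⟨(t, ψ), ⟨⟨h0, hT⟩, by simpa using hψ⟩, rfl⟩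

variable [NormedSpace ℝ E] {φ : History r E} {ε : ℝ} {I : Set ℝ} {x : ℝ → E}

theorem IsDelaySolution.zero_mem (h : IsDelaySolution f φ ε I x) (hε : 0 ≤ ε) (hr : 0 ≤ r) :
    (0 : ℝ) ∈ I :=
  h.initial_subset ⟨by nlinarith, le_rfl⟩

theorem IsDelaySolution.Icc_subset (h : IsDelaySolution f φ ε I x) (hε : 0 ≤ ε) (hr : 0 ≤ r)
    {t : ℝ} (ht : t ∈ I) : Set.Icc (-(ε * r)) t ⊆ I :=
  h.interval.out (h.initial_subset ⟨le_rfl, by nlinarith⟩) ht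

theorem div_mem_Icc_neg (hε : 0 < ε) {t : ℝ} (h1 : -(ε * r) ≤ t) (h2 : t ≤ 0) :
    t / ε ∈ Set.Icc (-r) 0 :=
  ⟨by rw [le_div_iff₀ hε]; linarith, div_nonpos_of_nonpos_of_nonneg h2 hε.le⟩

theorem IsDelaySolution.apply_eq (h : IsDelaySolution f φ ε I x) (hε : 0 < ε) {t : ℝ}
    (h1 : -(ε * r) ≤ t) (h2 : t ≤ 0) : x t = φ ⟨t / ε, div_mem_Icc_neg hε h1 h2⟩ := by
  rw [← h.initial]
  congr 1
  field_simp

/-- A bounded solution on a bounded interval extends to a continuous path on the whole line. -/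
theorem IsDelaySolution.exists_extension [FiniteDimensional ℝ E] (h : IsDelaySolution f φ ε I x)
    (hqb : IsQuasiBounded f) (hε : 0 < ε) (hr : 0 ≤ r) (hI : BddAbove I) {R : ℝ}
    (hR : ∀ t ∈ I, ‖x t‖ ≤ R) : ∃ z : C(ℝ, E), Set.EqOn x z I := by
  have h0 := h.zero_mem hε.le hr
  have hR0 : 0 ≤ R := (norm_nonneg _).trans (hR 0 h0)
  obtain ⟨b, hb⟩ := hI
  obtain ⟨M, hM0, hM⟩ := hqb.exists_norm_le (b / ε) R
  have hlip : LipschitzOnWith M.toNNReal x (I ∩ Set.Ici 0) := by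
    refine LipschitzOnWith.of_dist_le_mul fun s hs t ht => ?_
    rw [dist_eq_norm, dist_eq_norm, Real.coe_toNNReal _ hM0]
    refine Convex.norm_image_sub_le_of_norm_hasDerivWithin_le
      (fun t ht => h.deriv t ht.1 ht.2) (fun t ht => ?_)
      (h.interval.inter Set.ordConnected_Ici).convex ht hs
    refine hM _ (div_nonneg ht.2 hε.le) (by gcongr; exact hb ht.1) _ ?_
    refine norm_delaySegment_le hε.le hR0 fun s hs hst => hR s ?_
    exact h.Icc_subset hε.le hr ht.1 ⟨by linarith [ht.2.out], hst⟩
  obtain ⟨g, hg, hxg⟩ := hlip.extend_finite_dimension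
  have hg' := hg.continuous
  have hr' : -r ≤ 0 := by linarith
  -- The initial history and the Lipschitz extension `g` of the part after `0` are glued at `0`,
  -- where `g 0 = x 0 = φ 0`.
  refine ⟨⟨fun t => φ (Set.projIcc (-r) 0 hr' (min t 0 / ε)) + g (max t 0) - g 0, ?_⟩,
    fun t ht => ?_⟩
  · have : Continuous fun t => Set.projIcc (-r) 0 hr' (min t 0 / ε) :=
      continuous_projIcc.comp (by fun_prop)
    fun_prop
  · have e0 := hxg ⟨h0, Set.self_mem_Ici⟩
    simp only [ContinuousMap.coe_mk]
    rcases le_total t 0 with ht0 | ht0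
    · rw [max_eq_right ht0, min_eq_left ht0, add_sub_cancel_right, h.apply_eq hε (h.subset ht) ht0,
        Set.projIcc_of_mem hr' (div_mem_Icc_neg hε (h.subset ht) ht0)]
    · have hεr : -(ε * r) ≤ 0 := by nlinarith
      have e2 : φ (Set.projIcc (-r) 0 hr' (min t 0 / ε)) = x 0 := by
        rw [h.apply_eq hε hεr le_rfl, min_eq_right ht0,
          Set.projIcc_of_mem hr' (div_mem_Icc_neg hε hεr le_rfl)]
      rw [e2, ← e0, max_eq_left ht0, ← hxg ⟨ht, ht0⟩]
      abel

/-- The primitive of `v` with the same initial value agrees with `u` on `[a, b)`, hence on `[a, b]`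
by continuity, and it is differentiable at `b`. -/
theorem hasDerivWithinAt_Icc_of_Ico [CompleteSpace E] {u v : ℝ → E} {a b : ℝ} (hab : a ≤ b)
    (hu : Continuous u) (hv : Continuous v)
    (h : ∀ t ∈ Set.Ico a b, HasDerivWithinAt u (v t) (Set.Ico a b) t) :
    ∀ t ∈ Set.Icc a b, HasDerivWithinAt u (v t) (Set.Icc a b) t := by
  set w : ℝ → E := fun t => u a + ∫ s in a..t, v s with hw
  have hwd : ∀ t, HasDerivAt w (v t) t := fun t =>
    (hv.integral_hasStrictDerivAt a t).hasDerivAt.const_add (u a)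
  have hwc : Continuous w := continuous_iff_continuousAt.2 fun t => (hwd t).continuousAt
  have heq : Set.EqOn u w (Set.Icc a b) := by
    rcases hab.eq_or_lt with rfl | hlt
    · intro t ht
      rw [Set.Icc_self, Set.mem_singleton_iff] at ht
      simp [hw, ht]
    · rw [← closure_Ico hlt.ne]
      refine Set.EqOn.closure (fun t ht => ?_) hu hwc
      have := Convex.norm_image_sub_le_of_norm_hasDerivWithin_le (f := u - w) (f' := fun _ => 0)
        (C := 0) (s := Set.Ico a b) (fun s hs => by
          simpa using (h s hs).sub (hwd s).hasDerivWithinAt) (fun _ _ => by simp)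
        (convex_Ico a b) (Set.left_mem_Ico.2 hlt) ht
      rw [zero_mul, norm_le_zero_iff] at this
      simp only [hw, Pi.sub_apply, intervalIntegral.integral_same, add_zero, sub_self,
        sub_zero] at this
      exact sub_eq_zero.1 this
  exact fun t ht => (hwd t).hasDerivWithinAt.congr heq (heq ht)

/-- Local existence: a continuous path can be continued, beyond the time `β ≥ 0`, as a solution of
the delay equation. -/
theorem exists_local_continuation [FiniteDimensional ℝ E] (hf : IsContinuousField f)
    (hqb : IsQuasiBounded f) (hε : 0 < ε) {β : ℝ} (hβ : 0 ≤ β) (z : C(ℝ, E)) :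
    ∃ h > 0, ∃ u : C(ℝ, E), (∀ t ≤ β, u t = z t) ∧ ∀ t ∈ Set.Icc β (β + h),
      HasDerivWithinAt u (f (t / ε) (segment r ε t u)) (Set.Icc β (β + h)) t := by
  set R := ‖segment r ε β z‖ + 1
  obtain ⟨M, hM0, hM⟩ := hqb.exists_norm_le ((β + 1) / ε) (R + 1)
  -- The cutoff is `1` for `‖ψ‖ ≤ R` and `0` for `‖ψ‖ ≥ R + 1`, and time is clamped at `β + 1`, so
  -- quasi-boundedness bounds `F` globally. The history at `β` has norm `R - 1`, so the solution
  -- sees the uncut field for a while.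
  set F : C(ℝ × History r E, E) :=
    ⟨fun p => max 0 (min 1 (R + 1 - ‖p.2‖)) • rescaledField hf ε hε.le (min p.1 (β + 1), p.2),
      by fun_prop⟩ with hF
  have hFM : ∀ p, ‖F p‖ ≤ M := by
    rintro ⟨s, ψ⟩
    simp only [hF, ContinuousMap.coe_mk]
    rcases le_total ‖ψ‖ (R + 1) with hψ | hψ
    · rw [norm_smul, Real.norm_eq_abs, abs_of_nonneg (le_max_left _ _)]
      have h1 : ‖rescaledField hf ε hε.le (min s (β + 1), ψ)‖ ≤ M := by
        refine hM _ (div_nonneg (le_max_right _ _) hε.le) ?_ ψ hψ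
        gcongr
        exact max_le (min_le_right _ _) (by linarith)
      calc _ ≤ 1 * M := mul_le_mul (max_le zero_le_one (min_le_left _ _)) h1 (norm_nonneg _)
            zero_le_one
        _ = M := one_mul M
    · rw [max_eq_left ((min_le_right _ _).trans (by linarith)), zero_smul, norm_zero]
      exact hM0
  obtain ⟨u, huz, hu⟩ := exists_delay_solution F hFM hε.le β z
  have hseg : segment r ε β u = segment r ε β z := segment_congr hε.le fun t _ ht => huz t ht
  have hnear : ∀ᶠ s in 𝓝 β, ‖segment r ε s u‖ < R :=
    (continuous_segment_time ε u).norm.continuousAt.eventually_lt_const (by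
      simp only [hseg]; exact lt_add_one _)
  obtain ⟨ρ, hρ, H⟩ := Metric.eventually_nhds_iff.1 hnear
  refine ⟨min 1 (ρ / 2), by positivity, u, huz, fun t ht => ?_⟩
  have h1 : t ≤ β + 1 := ht.2.trans (by gcongr; exact min_le_left _ _)
  have h2 : t ≤ β + ρ / 2 := ht.2.trans (by gcongr; exact min_le_right _ _)
  have h3 : ‖segment r ε t u‖ < R := H (by
    rw [Real.dist_eq, abs_of_nonneg (by linarith [ht.1])]; linarith)
  have e : F (t, segment r ε t u) = f (t / ε) (segment r ε t u) := by
    simp only [hF, ContinuousMap.coe_mk]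
    rw [min_eq_left h1, rescaledField_apply hf hε.le (hβ.trans ht.1),
      min_eq_left (by linarith), max_eq_right zero_le_one, one_smul]
  rw [← e]
  exact (hu t ⟨ht.1, h1⟩).mono (Set.Icc_subset_Icc_right (by gcongr; exact min_le_left _ _))

/-- A maximal solution on a bounded interval is unbounded. -/
theorem IsMaximalDelaySolution.not_bddAbove [FiniteDimensional ℝ E]
    (h : IsMaximalDelaySolution f φ ε I x) (hf : IsContinuousField f)
    (hqb : IsQuasiBounded f) (hε : 0 < ε) (hr : 0 ≤ r) {R : ℝ}
    (hR : ∀ t ∈ I, ‖x t‖ ≤ R) : ¬ BddAbove I := by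
  intro hI
  have : CompleteSpace E := FiniteDimensional.complete ℝ E
  have hεr : 0 ≤ ε * r := by positivity
  obtain ⟨hsol, hmax⟩ := h
  have h0 := hsol.zero_mem hε.le hr
  obtain ⟨z, hxz⟩ := hsol.exists_extension hqb hε hr hI hR
  set β := sSup I
  have hIβ : ∀ t ∈ I, t ≤ β := fun t ht => le_csSup hI ht
  have hβ : 0 ≤ β := hIβ 0 h0
  -- The supremum `β` may or may not belong to `I`; working on `[0, β)` treats both cases.
  have hIco : Set.Ico 0 β ⊆ I := by
    intro t ht
    obtain ⟨i, hi, hti⟩ := exists_lt_of_lt_csSup ⟨0, h0⟩ ht.2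
    exact hsol.interval.out h0 hi ⟨ht.1, hti.le⟩
  obtain ⟨k, hk, u, huz, hu⟩ := exists_local_continuation hf hqb hε hβ z
  set v : ℝ → E := fun t => rescaledField hf ε hε.le (t, segment r ε t u) with hv
  have hvc : Continuous v := (rescaledField hf ε hε.le).continuous.comp
    (continuous_id.prodMk (continuous_segment_time ε u))
  have hxu : Set.EqOn x u I := fun t ht => (hxz ht).trans (huz t (hIβ t ht)).symm
  have hleft : ∀ t ∈ Set.Icc 0 β, HasDerivWithinAt u (v t) (Set.Icc 0 β) t := by
    refine hasDerivWithinAt_Icc_of_Ico hβ u.continuous hvc fun t ht => ?_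
    have h1 := (hsol.deriv t (hIco ht) ht.1).mono
      (fun s hs => ⟨hIco hs, hs.1⟩ : Set.Ico 0 β ⊆ I ∩ Set.Ici 0)
    have e : delaySegment r ε x t = segment r ε t u :=
      delaySegment_eq_segment hε.le fun s hs hst =>
        hxu (hsol.Icc_subset hε.le hr (hIco ht) ⟨by linarith [ht.1], hst⟩)
    rw [hv]
    simp only
    rw [rescaledField_apply hf hε.le ht.1, ← e]
    exact h1.congr (fun s hs => (hxu (hIco hs)).symm) (hxu (hIco ht)).symm
  have hall := hasDerivWithinAt_Icc_union hleft (c := β + k) fun t ht => by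
    rw [hv]
    simp only
    rw [rescaledField_apply hf hε.le (hβ.trans ht.1)]
    exact hu t ht
  have hnew : IsDelaySolution f φ ε (Set.Icc (-(ε * r)) (β + k)) u :=
    { interval := Set.ordConnected_Icc
      initial_subset := Set.Icc_subset_Icc_right (by linarith)
      subset := fun t ht => ht.1
      continuousOn := u.continuous.continuousOn
      initial := fun θ => by
        rw [← hsol.initial θ]
        refine (hxu (hsol.initial_subset ⟨?_, ?_⟩)).symm
        · nlinarith [θ.2.1]
        · nlinarith [θ.2.2]
      deriv := fun t ht ht0 => by
        have h1 := hall t ⟨ht0, ht.2⟩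
        rw [hv] at h1
        simp only at h1
        rw [rescaledField_apply hf hε.le ht0] at h1
        rw [delaySegment_eq_segment hε.le fun s _ _ => rfl]
        exact h1.mono fun s hs => ⟨hs.2, hs.1.2⟩ }
  have hsub := hmax _ _ hnew (fun t ht => ⟨hsol.subset ht, (hIβ t ht).trans (by linarith)⟩)
    fun t ht => (hxu ht).symm
  have := hIβ (β + k) (hsub ⟨by linarith, le_rfl⟩)
  linarith

end Continuation

end DelayAveraging

namespace DelayAveraging

/-! ### A priori velocity bounds. -/

section Averaging

variable {E : Type*} [NormedAddCommGroup E] {r : ℝ} {f : ℝ → History r E → E}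

theorem norm_const_sub_const_le (v w : E) :
    ‖(ContinuousMap.const _ v : History r E) - ContinuousMap.const _ w‖ ≤ ‖v - w‖ :=
  (ContinuousMap.norm_le _ (norm_nonneg _)).2 fun _ => le_rfl

/-- Near the constant histories with values in a compact set, the vector field is bounded. -/
theorem exists_bound_near_const (huc : IsUniformlyContinuousInState f)
    (hbd : ∀ ψ, ∃ M, 0 ≤ M ∧ ∀ t, 0 ≤ t → ‖f t ψ‖ ≤ M) {K : Set E} (hK : IsCompact K) :
    ∃ ρ > 0, ∃ M, 0 ≤ M ∧ ∀ v ∈ K, ∀ ψ : History r E, ‖ψ - ContinuousMap.const _ v‖ < ρ →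
      ∀ t, 0 ≤ t → ‖f t ψ‖ ≤ M := by
  refine hK.induction_on (p := fun S => ∃ ρ > 0, ∃ M, 0 ≤ M ∧ ∀ v ∈ S, ∀ ψ : History r E,
    ‖ψ - ContinuousMap.const _ v‖ < ρ → ∀ t, 0 ≤ t → ‖f t ψ‖ ≤ M) ?_ ?_ ?_ ?_
  · exact ⟨1, one_pos, 0, le_rfl, by simp⟩
  · rintro S S' hS ⟨ρ, hρ, M, hM0, hM⟩
    exact ⟨ρ, hρ, M, hM0, fun v hv => hM v (hS hv)⟩
  · rintro S S' ⟨ρ, hρ, M, hM0, hM⟩ ⟨ρ', hρ', M', hM0', hM'⟩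
    refine ⟨min ρ ρ', lt_min hρ hρ', max M M', le_max_of_le_left hM0, ?_⟩
    rintro v (hv | hv) ψ hψ t ht
    · exact (hM v hv ψ (hψ.trans_le (min_le_left _ _)) t ht).trans (le_max_left _ _)
    · exact (hM' v hv ψ (hψ.trans_le (min_le_right _ _)) t ht).trans (le_max_right _ _)
  · intro v _
    obtain ⟨ρ, hρ, H⟩ := huc (ContinuousMap.const _ v) 1 one_pos
    obtain ⟨M, hM0, hM⟩ := hbd (ContinuousMap.const _ v)
    refine ⟨Metric.ball v (ρ / 2), mem_nhdsWithin_of_mem_nhds (Metric.ball_mem_nhds v (by positivity)),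
      ρ / 2, by positivity, M + 1, by positivity, fun w hw ψ hψ t ht => ?_⟩
    rw [Metric.mem_ball, dist_eq_norm] at hw
    have h1 : ‖ψ - ContinuousMap.const _ v‖ < ρ := by
      have h2 := norm_const_sub_const_le (r := r) w v
      have h3 := norm_sub_le_norm_sub_add_norm_sub ψ (ContinuousMap.const _ w)
        (ContinuousMap.const _ v)
      linarith
    have h4 := H ψ h1 t ht
    have h5 := norm_le_norm_add_norm_sub' (f t ψ) (f t (ContinuousMap.const _ v))
    linarith [hM t ht]

/-- The path is frozen outside `[a, b]`. The formula is kept because it passes Lipschitz bounds on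
to the extension. -/
theorem exists_continuousMap_eqOn {X : Type*} [TopologicalSpace X] {x : ℝ → X} {a b : ℝ}
    (hab : a ≤ b) (hx : ContinuousOn x (Set.Icc a b)) :
    ∃ u : C(ℝ, X), (∀ t, u t = x (Set.projIcc a b hab t)) ∧ Set.EqOn x u (Set.Icc a b) := by
  refine ⟨⟨fun t => x (Set.projIcc a b hab t), hx.comp_continuous
    (continuous_subtype_val.comp continuous_projIcc) fun t => Subtype.coe_prop _⟩,
    fun t => rfl, fun t ht => ?_⟩
  simp only [ContinuousMap.coe_mk]
  rw [Set.projIcc_of_mem hab ht]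

variable [NormedSpace ℝ E] {φ : History r E} {ε : ℝ} {I : Set ℝ} {x : ℝ → E}

theorem IsDelaySolution.norm_sub_le (h : IsDelaySolution f φ ε I x) (hε : 0 < ε) (hr : 0 ≤ r)
    {T M : ℝ} (hT : T ∈ I)
    (hM : ∀ t ∈ Set.Icc 0 T, ‖f (t / ε) (delaySegment r ε x t)‖ ≤ M) {s t : ℝ}
    (hs : s ∈ Set.Icc 0 T) (ht : t ∈ Set.Icc 0 T) : ‖x t - x s‖ ≤ M * |t - s| := by
  have hsub : Set.Icc 0 T ⊆ I ∩ Set.Ici 0 := fun s hs =>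
    ⟨h.interval.out (h.zero_mem hε.le hr) hT hs, hs.1⟩
  exact Convex.norm_image_sub_le_of_norm_hasDerivWithin_le
    (fun t ht => (h.deriv t (hsub ht).1 ht.1).mono hsub) hM (convex_Icc 0 T) hs ht

/-- A priori bound for the velocity, as long as the solution stays in the compact set `K`. -/
theorem IsDelaySolution.norm_velocity_le (h : IsDelaySolution f φ ε I x)
    (hf : IsContinuousField f) (hε : 0 < ε) (hr : 0 ≤ r) {K : Set E} {ρ M R T : ℝ}
    (hM : 0 ≤ M)
    (hnear : ∀ v ∈ K, ∀ ψ : History r E, ‖ψ - ContinuousMap.const _ v‖ < ρ →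
      ∀ t, 0 ≤ t → ‖f t ψ‖ ≤ M)
    (hearly : ∀ t, 0 ≤ t → t ≤ r → ∀ ψ : History r E, ‖ψ‖ ≤ R → ‖f t ψ‖ ≤ M)
    (hφ : ‖φ‖ ≤ R) (hKR : ∀ v ∈ K, ‖v‖ ≤ R) (hρ : ε * r * (M + 1) < ρ) (hT : T ∈ I)
    (hxK : ∀ t ∈ Set.Icc 0 T, x t ∈ K) :
    ∀ t ∈ Set.Icc 0 T, ‖f (t / ε) (delaySegment r ε x t)‖ ≤ M + 1 := by
  intro t ht
  have hT0 : 0 ≤ T := ht.1.trans ht.2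
  have hεr : 0 ≤ ε * r := by positivity
  have hR0 : 0 ≤ R := (norm_nonneg _).trans hφ
  have hsub := h.Icc_subset hε.le hr hT
  obtain ⟨z, -, hxz⟩ := exists_continuousMap_eqOn (by linarith) (h.continuousOn.mono hsub)
  set g : ℝ → ℝ := fun s => ‖rescaledField hf ε hε.le (s, segment r ε s z)‖ with hg
  have hgc : Continuous g := ((rescaledField hf ε hε.le).continuous.comp
    (continuous_id.prodMk (continuous_segment_time ε z))).norm
  have hge : ∀ s ∈ Set.Icc 0 T, g s = ‖f (s / ε) (delaySegment r ε x s)‖ := by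
    intro s hs
    rw [delaySegment_eq_segment hε.le fun s' hs' hss' =>
      hxz ⟨by linarith [hs.1], hss'.trans hs.2⟩]
    simp only [hg]
    rw [rescaledField_apply hf hε.le hs.1]
  have hbound : ∀ s ∈ Set.Icc (-(ε * r)) T, ‖x s‖ ≤ R := by
    intro s hs
    rcases le_total s 0 with h0 | h0
    · rw [h.apply_eq hε hs.1 h0]
      exact (φ.norm_coe_le_norm _).trans hφ
    · exact hKR _ (hxK s ⟨h0, hs.2⟩)
  -- In the initial layer the history still contains values of `φ` and need not be nearly constant,
  -- but the fast time `s / ε` is at most `r`.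
  have hgearly : ∀ s ∈ Set.Icc 0 T, s ≤ ε * r → g s ≤ M := by
    intro s hs hsr
    rw [hge s hs]
    refine hearly _ (div_nonneg hs.1 hε.le) (by rw [div_le_iff₀ hε]; linarith) _ ?_
    exact norm_delaySegment_le hε.le hR0 fun s' hs' hss' =>
      hbound s' ⟨by linarith [hs.1], hss'.trans hs.2⟩
  rw [← hge t ht]
  by_contra! hgt
  -- Bootstrap: until the speed first reaches `M + 1`, a history after the layer varies by at most
  -- `ε r (M + 1) < ρ`, so it is near a constant and the speed is in fact at most `M`.
  obtain ⟨t₁, ht₁, hgt₁, hlt⟩ := exists_first_time hgc.continuousOn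
    ((hgearly 0 ⟨le_rfl, hT0⟩ hεr).trans (by linarith)) ht hgt.le
  have hle : ∀ s ∈ Set.Icc 0 t₁, ‖f (s / ε) (delaySegment r ε x s)‖ ≤ M + 1 := by
    intro s hs
    rw [← hge s ⟨hs.1, hs.2.trans ht₁.2⟩]
    rcases hs.2.eq_or_lt with rfl | hlt'
    · exact hgt₁.le
    · exact (hlt s ⟨hs.1, hlt'⟩).le
  suffices g t₁ ≤ M by linarith
  rcases le_total t₁ (ε * r) with hearly₁ | hlate
  · exact hgearly t₁ ht₁ hearly₁
  · rw [hge t₁ ht₁]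
    refine hnear (x t₁) (hxK t₁ ht₁) _ (lt_of_le_of_lt ?_ hρ) _ (div_nonneg ht₁.1 hε.le)
    rw [delaySegment_eq_segment hε.le fun s' hs' hss' =>
      hxz ⟨by linarith [ht₁.1], hss'.trans ht₁.2⟩]
    rw [ContinuousMap.norm_le _ (by positivity)]
    intro θ
    have h1 := θ.2.1
    have h2 := θ.2.2
    have h3 : t₁ + ε * (θ : ℝ) ∈ Set.Icc 0 t₁ := ⟨by nlinarith, by nlinarith⟩
    have h4 := h.norm_sub_le hε hr (hsub ⟨by linarith [ht₁.1], ht₁.2⟩) hle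
      (Set.right_mem_Icc.2 ht₁.1) h3
    simp only [ContinuousMap.sub_apply, segment_apply, ContinuousMap.const_apply]
    rw [← hxz ⟨by linarith [h3.1], h3.2.trans ht₁.2⟩]
    refine h4.trans ?_
    rw [mul_comm]
    gcongr
    rw [add_sub_cancel_left, abs_le]
    constructor <;> nlinarith

/-! ### Rescaled means and the limit equation. -/

theorem exists_norm_integral_sub_smul_le {g : ℝ → E} (hg : Continuous g) {m : E}
    (hm : Tendsto (fun T : ℝ => (1 / T) • ∫ t in (0 : ℝ)..T, g t) atTop (𝓝 m)) {η : ℝ}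
    (hη : 0 < η) :
    ∃ C, 0 ≤ C ∧ ∀ T, 0 ≤ T → ‖(∫ t in (0 : ℝ)..T, g t) - T • m‖ ≤ η * T + C := by
  obtain ⟨T₀, hT₀⟩ := eventually_atTop.1
    ((hm.eventually (Metric.closedBall_mem_nhds m hη)).and (eventually_gt_atTop 0))
  have hT₀0 : 0 < T₀ := (hT₀ T₀ le_rfl).2
  have hcont : Continuous fun T => (∫ t in (0 : ℝ)..T, g t) - T • m :=
    (intervalIntegral.continuous_primitive (μ := MeasureTheory.volume)
      (fun a b => hg.intervalIntegrable a b) 0).sub (by fun_prop)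
  obtain ⟨C, hC⟩ := (isCompact_Icc (a := (0 : ℝ)) (b := T₀)).exists_bound_of_continuousOn
    hcont.continuousOn
  have hC0 : 0 ≤ C := (norm_nonneg _).trans (hC 0 ⟨le_rfl, hT₀0.le⟩)
  refine ⟨C, hC0, fun T hT => ?_⟩
  rcases le_total T T₀ with hle | hle
  · have := hC T ⟨hT, hle⟩
    have : 0 ≤ η * T := by positivity
    linarith
  · obtain ⟨h1, h2⟩ := hT₀ T hle
    rw [dist_eq_norm] at h1
    have e : (∫ t in (0 : ℝ)..T, g t) - T • m =
        T • ((1 / T) • (∫ t in (0 : ℝ)..T, g t) - m) := by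
      rw [smul_sub, smul_smul, mul_one_div_cancel h2.ne', one_smul]
    rw [e, norm_smul, Real.norm_eq_abs, abs_of_pos h2]
    nlinarith

/-- Multiplying the bound `η T + C` at `T = a / ε` by `ε` gives `η a + ε C`, which allows a moving
end point `a`, even one tending to `0`. -/
theorem tendsto_smul_integral {ι : Type*} {l : Filter ι} {g : ℝ → E} (hg : Continuous g) {m : E}
    (hm : Tendsto (fun T : ℝ => (1 / T) • ∫ t in (0 : ℝ)..T, g t) atTop (𝓝 m))
    {ε a : ι → ℝ} {a₀ : ℝ} (hε : ∀ i, 0 < ε i) (hε0 : Tendsto ε l (𝓝 0)) (ha : ∀ i, 0 ≤ a i)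
    (ha0 : Tendsto a l (𝓝 a₀)) :
    Tendsto (fun i => ε i • ∫ t in (0 : ℝ)..(a i / ε i), g t) l (𝓝 (a₀ • m)) := by
  have key : Tendsto (fun i => (ε i • ∫ t in (0 : ℝ)..(a i / ε i), g t) - a i • m) l (𝓝 0) := by
    rw [Metric.tendsto_nhds]
    intro κ hκ
    set η := κ / (2 * (|a₀| + 1)) with hη
    have hη0 : 0 < η := by positivity
    obtain ⟨C, hC0, hC⟩ := exists_norm_integral_sub_smul_le hg hm hη0
    have hlim : Tendsto (fun i => η * a i + ε i * C) l (𝓝 (η * a₀ + 0 * C)) :=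
      (ha0.const_mul η).add (hε0.mul_const C)
    have hlt : η * a₀ + 0 * C < κ := by
      have h1 : η * (|a₀| + 1) = κ / 2 := by rw [hη]; field_simp
      have h2 : η * a₀ ≤ η * (|a₀| + 1) := by
        gcongr; linarith [le_abs_self a₀]
      linarith
    filter_upwards [hlim.eventually_lt_const hlt] with i hi
    rw [dist_zero_right]
    refine lt_of_le_of_lt ?_ hi
    have e : (ε i • ∫ t in (0 : ℝ)..(a i / ε i), g t) - a i • m =
        ε i • ((∫ t in (0 : ℝ)..(a i / ε i), g t) - (a i / ε i) • m) := by
      rw [smul_sub, smul_smul, mul_div_cancel₀ _ (hε i).ne']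
    rw [e, norm_smul, Real.norm_eq_abs, abs_of_pos (hε i)]
    calc _ ≤ ε i * (η * (a i / ε i) + C) := by
          gcongr
          · exact (hε i).le
          · exact hC _ (div_nonneg (ha i) (hε i).le)
      _ = η * a i + ε i * C := by
          have := (hε i).ne'
          field_simp
  simpa using key.add (ha0.smul_const m)

/-- The limit of solutions of the delay problems solves the averaged equation. -/
theorem hasDerivWithinAt_of_tendsto [CompleteSpace E] {ι : Type*} {l : Filter ι} [l.NeBot]
    (hf : IsContinuousField f) (huc : IsUniformlyContinuousInState f) (hr : 0 ≤ r)
    (hmean : ∀ ψ, Tendsto (timeMean f ψ) atTop (𝓝 (average f ψ)))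
    {ε : ι → ℝ} (hε : ∀ i, 0 < ε i) (hε0 : Tendsto ε l (𝓝 0)) {I : ι → Set ℝ} {x : ι → ℝ → E}
    (hx : ∀ i, IsDelaySolution f φ (ε i) (I i) (x i)) {T : ι → ℝ} {T₀ : ℝ} (hT : ∀ i, T i ∈ I i)
    (hT0 : Tendsto T l (𝓝 T₀)) {u : ι → C(ℝ, E)} {u₀ : C(ℝ, E)}
    (hxu : ∀ i, Set.EqOn (x i) (u i) (Set.Icc 0 (T i))) (hu : Tendsto u l (𝓝 u₀)) {s : ℝ}
    (hs : s ∈ Set.Ico 0 T₀) :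
    HasDerivWithinAt u₀ (averagedField f (u₀ s)) (Set.Ico 0 T₀) s := by
  set ψ : History r E := ContinuousMap.const _ (u₀ s)
  set m := averagedField f (u₀ s)
  set g : ℝ → E := fun t => f (max t 0) ψ with hg
  have hgc : Continuous g := (hf.continuousOn_time ψ).comp_continuous (by fun_prop)
    fun t => le_max_right t 0
  have hgm : Tendsto (fun T : ℝ => (1 / T) • ∫ t in (0 : ℝ)..T, g t) atTop (𝓝 m) := by
    refine (hmean ψ).congr' ?_
    filter_upwards [eventually_ge_atTop 0] with T hT
    rw [timeMean]
    congr 1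
    refine intervalIntegral.integral_congr fun t ht => ?_
    rw [Set.uIcc_of_le hT] at ht
    simp [hg, ht.1]
  refine hasDerivWithinAt_of_forall_norm_le fun η hη => ?_
  obtain ⟨ρ, hρ, H⟩ := huc ψ η hη
  have hseg : Tendsto (fun q : ι × ℝ => segment r (ε q.1) q.2 (u q.1)) (l ×ˢ 𝓝 s) (𝓝 ψ) := by
    have h1 : Tendsto (fun q : ι × ℝ => (u q.1, ε q.1, q.2)) (l ×ˢ 𝓝 s) (𝓝 (u₀, 0, s)) :=
      (hu.comp tendsto_fst).prodMk_nhds ((hε0.comp tendsto_fst).prodMk_nhds tendsto_snd)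
    have h2 := ((continuous_segment (r := r)).tendsto (u₀, 0, s)).comp h1
    simp only [segment_zero] at h2
    exact h2
  obtain ⟨p, hp, p', hp', Hp⟩ := eventually_prod_iff.1
    (hseg.eventually (Metric.ball_mem_nhds ψ hρ))
  obtain ⟨κ, hκ, hκ'⟩ := Metric.eventually_nhds_iff.1 hp'
  have key : ∀ a b, 0 ≤ a → a < b → b < T₀ → (∀ σ ∈ Set.Icc a b, |σ - s| < κ) →
      ‖(u₀ b - b • m) - (u₀ a - a • m)‖ ≤ η * (b - a) := by
    intro a b ha hab hb hσ
    -- Starting after the initial layer makes the whole history lie in `[0, T i]`, where `x i`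
    -- agrees with `u i`; the loss vanishes as `ε i → 0`.
    set a' : ι → ℝ := fun i => max a (ε i * r) with ha'
    have ha'0 : ∀ i, 0 ≤ a' i := fun i => ha.trans (le_max_left _ _)
    have ha'lim : Tendsto a' l (𝓝 a) := by
      have : Tendsto a' l (𝓝 (max a (0 * r))) := tendsto_const_nhds.max (hε0.mul_const r)
      rwa [zero_mul, max_eq_left ha] at this
    -- `P i` integrates the field at the frozen history `ψ`; the velocity of `x i - P i` is at most
    -- `η` on the window, and `P i` tends to `t • m`.
    set P : ι → ℝ → E := fun i t => ε i • ∫ σ in (0 : ℝ)..(t / ε i), g σ with hP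
    have hPd : ∀ i t, HasDerivAt (P i) (g (t / ε i)) t := by
      intro i t
      have h1 := (hgc.integral_hasStrictDerivAt 0 (t / ε i)).hasDerivAt
      have h2 := (h1.scomp t ((hasDerivAt_id t).div_const (ε i))).const_smul (ε i)
      rw [smul_smul, mul_one_div_cancel (hε i).ne', one_smul] at h2
      exact h2
    have hub : Tendsto (fun i => u i b) l (𝓝 (u₀ b)) :=
      ((continuous_eval_const b).tendsto u₀).comp hu
    have hua : Tendsto (fun i => u i (a' i)) l (𝓝 (u₀ a)) :=
      ((by fun_prop : Continuous fun q : C(ℝ, E) × ℝ => q.1 q.2).tendsto (u₀, a)).comp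
        (hu.prodMk_nhds ha'lim)
    have hPb : Tendsto (fun i => P i b) l (𝓝 (b • m)) :=
      tendsto_smul_integral hgc hgm hε hε0 (fun _ => ha.trans hab.le) tendsto_const_nhds
    have hPa : Tendsto (fun i => P i (a' i)) l (𝓝 (a • m)) :=
      tendsto_smul_integral hgc hgm hε hε0 ha'0 ha'lim
    refine le_of_tendsto_of_tendsto ((hub.sub hPb).sub (hua.sub hPa)).norm
      ((ha'lim.const_sub b).const_mul η) ?_
    filter_upwards [hp, hT0.eventually_const_lt hb, ha'lim.eventually_lt_const hab]
      with i hi hTi hai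
    have hsubT : Set.Icc (a' i) b ⊆ Set.Icc 0 (T i) :=
      Set.Icc_subset_Icc (ha'0 i) hTi.le
    have hsub : Set.Icc (a' i) b ⊆ I i ∩ Set.Ici 0 := fun σ hσ =>
      ⟨(hx i).interval.out ((hx i).zero_mem (hε i).le hr) (hT i) (hsubT hσ), (hsubT hσ).1⟩
    have hmv := Convex.norm_image_sub_le_of_norm_hasDerivWithin_le (f := fun t => x i t - P i t)
      (f' := fun t => f (t / ε i) (delaySegment r (ε i) (x i) t) - g (t / ε i)) (C := η)
      (s := Set.Icc (a' i) b)
      (fun σ hσ => (((hx i).deriv σ (hsub hσ).1 (hsub hσ).2).mono hsub).sub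
        (hPd i σ).hasDerivWithinAt) (fun σ hσ' => by
        have hσ0 := (hsubT hσ').1
        have hlate : ε i * r ≤ σ := (le_max_right _ _).trans hσ'.1
        rw [delaySegment_eq_segment (hε i).le fun t ht htσ =>
          hxu i ⟨by linarith, htσ.trans (hsubT hσ').2⟩]
        have h0 : 0 ≤ σ / ε i := div_nonneg hσ0 (hε i).le
        simp only [hg, max_eq_left h0]
        refine (H _ ?_ _ h0).le
        rw [← dist_eq_norm]
        exact Hp hi (hκ' (hσ σ ⟨(le_max_left _ _).trans hσ'.1, hσ'.2⟩)))
      (convex_Icc _ _) (Set.left_mem_Icc.2 hai.le) (Set.right_mem_Icc.2 hai.le)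
    simp only [Real.norm_eq_abs] at hmv
    rwa [abs_of_nonneg (by linarith), hxu i (hsubT (Set.left_mem_Icc.2 hai.le)),
      hxu i (hsubT (Set.right_mem_Icc.2 hai.le))] at hmv
  refine ⟨κ, hκ, fun t ht hts => ?_⟩
  rcases lt_trichotomy s t with h | rfl | h
  · have := key s t hs.1 h ht.2 fun σ hσ => by
      rw [abs_of_nonneg (by linarith)] at hts
      rw [abs_of_nonneg (by linarith [hσ.1])]
      linarith [hσ.2]
    rw [abs_of_pos (by linarith), sub_smul]
    convert this using 2
    abel
  · simp
  · have := key t s ht.1 h hs.2 fun σ hσ => by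
      rw [abs_of_neg (by linarith)] at hts
      rw [abs_of_nonpos (by linarith [hσ.2])]
      linarith [hσ.1]
    rw [abs_of_neg (by linarith), sub_smul, neg_sub, ← norm_neg]
    have e : -(u₀ t - u₀ s - (t • m - s • m)) = u₀ s - s • m - (u₀ t - t • m) := by abel
    rwa [e]

/-! ### Exit times and the compactness argument. -/

/-- If the conclusion of the averaging theorem fails for a maximal solution, then there is a first
time at which its distance to the averaged solution is `δ`. -/
theorem IsMaximalDelaySolution.exists_exit_time [FiniteDimensional ℝ E]
    (h : IsMaximalDelaySolution f φ ε I x) (hf : IsContinuousField f) (hqb : IsQuasiBounded f)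
    (hε : 0 < ε) (hr : 0 ≤ r) {y : ℝ → E} {L δ : ℝ}
    (hy : ContinuousOn y (Set.Icc 0 L)) (h0 : ‖x 0 - y 0‖ < δ)
    (hfail : ¬ (Set.Icc (-(ε * r)) L ⊆ I ∧ ∀ t ∈ Set.Icc 0 L, ‖x t - y t‖ < δ)) :
    ∃ T ∈ Set.Icc 0 L, T ∈ I ∧ ‖x T - y T‖ = δ ∧ ∀ t ∈ Set.Ico 0 T, ‖x t - y t‖ < δ := by
  have h0I := h.1.zero_mem hε.le hr
  have hfirst : ∀ t ∈ I, t ∈ Set.Icc 0 L → δ ≤ ‖x t - y t‖ →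
      ∃ T ∈ Set.Icc 0 L, T ∈ I ∧ ‖x T - y T‖ = δ ∧ ∀ t ∈ Set.Ico 0 T, ‖x t - y t‖ < δ := by
    intro t htI ht hδ
    have hsub : Set.Icc 0 t ⊆ I := h.1.interval.out h0I htI
    obtain ⟨T, hT, hTδ, hlt⟩ := exists_first_time (g := fun s => ‖x s - y s‖) (a := 0) (b := t)
      (((h.1.continuousOn.mono hsub).sub (hy.mono (Set.Icc_subset_Icc_right ht.2))).norm)
      h0.le ⟨ht.1, le_rfl⟩ hδ
    exact ⟨T, ⟨hT.1, hT.2.trans ht.2⟩, hsub hT, hTδ, hlt⟩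
  by_cases hL : L ∈ I
  · have hsub := h.1.Icc_subset hε.le hr hL
    have : ∃ t ∈ Set.Icc 0 L, δ ≤ ‖x t - y t‖ := by
      by_contra! hcon
      exact hfail ⟨hsub, hcon⟩
    obtain ⟨t, ht, hδ⟩ := this
    exact hfirst t (hsub ⟨by nlinarith [ht.1], ht.2⟩) ht hδ
  · have hIL : ∀ t ∈ I, 0 ≤ L → t ≤ L := fun t ht hL0 => by
      by_contra! hlt
      exact hL (h.1.interval.out h0I ht ⟨hL0, hlt.le⟩)
    rcases lt_or_ge L 0 with hneg | hL0
    · refine absurd ?_ hfail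
      exact ⟨fun t ht => h.1.initial_subset ⟨ht.1, ht.2.trans hneg.le⟩,
        fun t ht => absurd (ht.1.trans ht.2) (not_le.2 hneg)⟩
    -- Without an exit time the solution stays within `δ` of the bounded path `y` on an interval
    -- bounded by `L`, which maximality excludes.
    · by_contra! hcon
      obtain ⟨B, hB⟩ := isCompact_Icc.exists_bound_of_continuousOn hy
      refine h.not_bddAbove hf hqb hε hr (R := max ‖φ‖ (B + δ)) (fun t ht => ?_)
        ⟨L, fun t ht => hIL t ht hL0⟩
      rcases le_total t 0 with ht0 | ht0
      · rw [h.1.apply_eq hε (h.1.subset ht) ht0]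
        exact (φ.norm_coe_le_norm _).trans (le_max_left _ _)
      · have htL : t ∈ Set.Icc 0 L := ⟨ht0, hIL t ht hL0⟩
        have h1 : ‖x t - y t‖ < δ := by
          by_contra! hδ
          obtain ⟨T, hT, hTI, hTδ, hlt⟩ := hfirst t ht htL hδ
          obtain ⟨s, hs, hsδ⟩ := hcon T hT hTI hTδ
          exact absurd (hlt s hs) (not_lt.2 hsδ)
        refine le_trans ?_ (le_max_right _ _)
        linarith [hB t htL, norm_le_norm_add_norm_sub' (x t) (y t)]

/-- The averaging principle, for fields that are continuous in the state uniformly in time, are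
bounded in time for each state, and have a mean. -/
theorem averaging_principle [FiniteDimensional ℝ E] (hr : 0 ≤ r)
    (hf : IsContinuousField f) (hqb : IsQuasiBounded f) (huc : IsUniformlyContinuousInState f)
    (hbd : ∀ ψ, ∃ M, 0 ≤ M ∧ ∀ t, 0 ≤ t → ‖f t ψ‖ ≤ M)
    (hmean : ∀ ψ, Tendsto (timeMean f ψ) atTop (𝓝 (average f ψ)))
    {v₀ : E} (hv₀ : v₀ = φ ⟨0, neg_nonpos.2 hr, le_rfl⟩) {J : Set ℝ} {y : ℝ → E}
    (hy : IsODESolution (averagedField f) v₀ J y)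
    (huniq : ∀ (J' : Set ℝ) (y' : ℝ → E), IsODESolution (averagedField f) v₀ J' y' →
      Set.EqOn y' y (J' ∩ J)) {L : ℝ} (hL : L ∈ J) {δ : ℝ} (hδ : 0 < δ) :
    ∃ ε₀ : ℝ, 0 < ε₀ ∧ ∀ ε : ℝ, 0 < ε → ε ≤ ε₀ →
      ∀ (I : Set ℝ) (x : ℝ → E), IsMaximalDelaySolution f φ ε I x →
        Set.Icc (-(ε * r)) L ⊆ I ∧ ∀ t ∈ Set.Icc 0 L, ‖x t - y t‖ < δ := by
  have : ProperSpace E := FiniteDimensional.proper ℝ E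
  have : CompleteSpace E := FiniteDimensional.complete ℝ E
  have hLJ : Set.Icc 0 L ⊆ J := hy.interval.out hy.zero_mem hL
  have hyc : ContinuousOn y (Set.Icc 0 L) := fun t ht =>
    (hy.deriv t (hLJ ht)).continuousWithinAt.mono hLJ
  set K := Metric.cthickening δ (y '' Set.Icc 0 L)
  have hK : IsCompact K := (isCompact_Icc.image_of_continuousOn hyc).cthickening
  obtain ⟨ρ, hρ, M₁, hM₁0, hM₁⟩ := exists_bound_near_const huc hbd hK
  obtain ⟨RK, hRK⟩ := hK.isBounded.exists_norm_le
  set R := max ‖φ‖ RK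
  obtain ⟨M₂, hM₂0, hM₂⟩ := hqb.exists_norm_le r R
  set M := max M₁ M₂
  have hM0 : 0 ≤ M := le_max_of_le_left hM₁0
  -- The added `1` gives a positive denominator and the strict bound `ε r (M + 1) < ρ`.
  set ε₁ := ρ / (r * (M + 1) + 1) with hε₁
  have hε₁0 : 0 < ε₁ := by positivity
  have hε₁ρ : ∀ ε, 0 < ε → ε ≤ ε₁ → ε * r * (M + 1) < ρ := by
    intro ε hε hle
    rw [hε₁, le_div_iff₀ (by positivity)] at hle
    nlinarith
  by_contra! hcon
  choose ε hε hεle I x hmax hfail' using fun n : ℕ =>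
    hcon (min ε₁ (1 / ((n : ℝ) + 1))) (lt_min hε₁0 (by positivity))
  have hfail : ∀ n, ¬ (Set.Icc (-(ε n * r)) L ⊆ I n ∧ ∀ t ∈ Set.Icc 0 L, ‖x n t - y t‖ < δ) := by
    rintro n ⟨h1, h2⟩
    obtain ⟨t, ht, hle⟩ := hfail' n h1
    exact absurd (h2 t ht) (not_lt.2 hle)
  have hx0 : ∀ n, x n 0 = v₀ := fun n => by
    have := (hmax n).1.initial ⟨0, neg_nonpos.2 hr, le_rfl⟩
    rwa [mul_zero, ← hv₀] at this
  choose T hTL hTI hTδ hTlt using fun n => (hmax n).exists_exit_time hf hqb (hε n) hr hyc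
    (by rw [hx0, hy.initial, sub_self, norm_zero]; exact hδ) (hfail n)
  have hvel : ∀ n, ∀ t ∈ Set.Icc 0 (T n),
      ‖f (t / ε n) (delaySegment r (ε n) (x n) t)‖ ≤ M + 1 := by
    intro n
    refine (hmax n).1.norm_velocity_le hf (hε n) hr (K := K) (ρ := ρ) (R := R) hM0 ?_ ?_
      (le_max_left _ _) (fun v hv => (hRK v hv).trans (le_max_right _ _))
      (hε₁ρ _ (hε n) ((hεle n).trans (min_le_left _ _))) (hTI n) fun t ht => ?_
    · exact fun v hv ψ hψ t ht => (hM₁ v hv ψ hψ t ht).trans (le_max_left _ _)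
    · exact fun t h0 ht ψ hψ => (hM₂ t h0 ht ψ hψ).trans (le_max_right _ _)
    · refine Metric.mem_cthickening_of_dist_le _ (y t) _ _
        ⟨t, ⟨ht.1, ht.2.trans (hTL n).2⟩, rfl⟩ ?_
      rw [dist_eq_norm]
      rcases ht.2.eq_or_lt with rfl | hlt
      · exact (hTδ n).le
      · exact (hTlt n t ⟨ht.1, hlt⟩).le
  have hsubI : ∀ n, Set.Icc 0 (T n) ⊆ I n := fun n =>
    (hmax n).1.interval.out ((hmax n).1.zero_mem (hε n).le hr) (hTI n)
  choose u hu hxu using fun n =>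
    exists_continuousMap_eqOn (hTL n).1 ((hmax n).1.continuousOn.mono (hsubI n))
  have hlip : ∀ n, LipschitzWith (M + 1).toNNReal (u n) := by
    intro n
    refine LipschitzWith.of_dist_le_mul fun a b => ?_
    rw [hu, hu, dist_eq_norm, Real.coe_toNNReal _ (by positivity)]
    refine ((hmax n).1.norm_sub_le (hε n) hr (hTI n) (hvel n) (Subtype.coe_prop _)
      (Subtype.coe_prop _)).trans ?_
    gcongr
    have := (LipschitzWith.projIcc (hTL n).1).dist_le_mul a b
    simpa [Subtype.dist_eq, Real.dist_eq] using this
  have hu0 : ∀ n, u n 0 = v₀ := fun n => by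
    rw [← hxu n ⟨le_rfl, (hTL n).1⟩, hx0]
  set 𝒰 : Ultrafilter ℕ := hyperfilter ℕ
  obtain ⟨u₀, hu₀⟩ := exists_tendsto_of_lipschitzWith 𝒰 (t₀ := 0) (R := ‖v₀‖)
    (Eventually.of_forall hlip) (Eventually.of_forall fun n => by rw [hu0])
  obtain ⟨T₀, hT₀L, hT₀ : Tendsto T 𝒰 (𝓝 T₀)⟩ := isCompact_Icc.ultrafilter_le_nhds (𝒰.map T)
    (le_principal_iff.2 (Eventually.of_forall hTL : ∀ᶠ n in (𝒰 : Filter ℕ), T n ∈ Set.Icc 0 L))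
  have hε0 : Tendsto ε 𝒰 (𝓝 0) := by
    refine Tendsto.mono_left ?_ (Nat.hyperfilter_le_atTop)
    exact squeeze_zero (fun n => (hε n).le) (fun n => (hεle n).trans (min_le_right _ _))
      tendsto_one_div_add_atTop_nhds_zero_nat
  have hu₀0 : u₀ 0 = v₀ := by
    refine tendsto_nhds_unique (((continuous_eval_const (0 : ℝ)).tendsto u₀).comp hu₀) ?_
    exact tendsto_const_nhds.congr fun n => (hu0 n).symm
  have hgap : ‖u₀ T₀ - y T₀‖ = δ := by
    have h1 : Tendsto (fun n => u n (T n)) 𝒰 (𝓝 (u₀ T₀)) :=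
      ((by fun_prop : Continuous fun q : C(ℝ, E) × ℝ => q.1 q.2).tendsto (u₀, T₀)).comp
        (hu₀.prodMk_nhds hT₀)
    have h2 : Tendsto (fun n => y (T n)) 𝒰 (𝓝 (y T₀)) :=
      (hyc T₀ hT₀L).tendsto.comp (tendsto_nhdsWithin_iff.2 ⟨hT₀, Eventually.of_forall hTL⟩)
    refine tendsto_nhds_unique (h1.sub h2).norm (tendsto_const_nhds.congr fun n => ?_)
    rw [← hxu n ⟨(hTL n).1, le_rfl⟩, hTδ]
  have heq : u₀ T₀ = y T₀ := by
    rcases hT₀L.1.eq_or_lt with h0 | hpos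
    · rw [← h0, hu₀0, hy.initial]
    -- The interval is half-open because `T n` may stay below `T₀`; the value at `T₀` is recovered
    -- by continuity.
    · have hsol : IsODESolution (averagedField f) v₀ (Set.Ico 0 T₀) u₀ :=
        { interval := Set.ordConnected_Ico
          zero_mem := ⟨le_rfl, hpos⟩
          nonneg := fun t ht => ht.1
          initial := hu₀0
          deriv := fun t ht => hasDerivWithinAt_of_tendsto hf huc hr hmean hε hε0
            (fun n => (hmax n).1) hTI hT₀ hxu hu₀ ht }
      have h1 : Set.EqOn u₀ y (Set.Ico 0 T₀) := fun t ht =>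
        huniq _ _ hsol ⟨ht, hLJ ⟨ht.1, ht.2.le.trans hT₀L.2⟩⟩
      exact h1.of_subset_closure u₀.continuous.continuousOn
        (hyc.mono (Set.Icc_subset_Icc_right hT₀L.2)) Set.Ico_subset_Icc_self
        (closure_Ico hpos.ne).ge ⟨hpos.le, le_rfl⟩
  rw [heq, sub_self, norm_zero] at hgap
  exact hδ.ne hgap

end Averaging

end DelayAveraging

theorem corollary2p5 {E : Type*} [NormedAddCommGroup E] [NormedSpace ℝ E] [FiniteDimensional ℝ E]
    (r : ℝ) (hr : 0 ≤ r) (f : ℝ → History r E → E) (φ : History r E)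
    (hf : IsContinuousField f)
    (hcase : IsPeriodicInTime f ∨ IsSumOfPeriodic f ∨
      (IsAlmostPeriodicInTime f ∧ IsUniformlyContinuousInState f))
    (hqb : IsQuasiBounded f) :
    (∀ ψ : History r E, Tendsto (timeMean f ψ) atTop (𝓝 (average f ψ))) ∧
    (HasUniqueODESolution (averagedField f) (φ ⟨0, neg_nonpos.2 hr, le_rfl⟩) →
      ∀ (J : Set ℝ) (y : ℝ → E),
        IsMaximalODESolution (averagedField f) (φ ⟨0, neg_nonpos.2 hr, le_rfl⟩) J y →
        ∀ L ∈ J, ∀ δ : ℝ, 0 < δ → ∃ ε₀ : ℝ, 0 < ε₀ ∧ ∀ ε : ℝ, 0 < ε → ε ≤ ε₀ →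
          ∀ (I : Set ℝ) (x : ℝ → E), IsMaximalDelaySolution f φ ε I x →
            Set.Icc (-(ε * r)) L ⊆ I ∧ ∀ t ∈ Set.Icc 0 L, ‖x t - y t‖ < δ) := by
  have : CompleteSpace E := FiniteDimensional.complete ℝ E
  obtain ⟨huc, hbd, hmean'⟩ := averaging_hypotheses hf hcase
  have hmean : ∀ ψ, Tendsto (timeMean f ψ) atTop (𝓝 (average f ψ)) := fun ψ =>
    tendsto_nhds_limUnder (hmean' ψ)
  refine ⟨hmean, fun hun J y hy L hL δ hδ => ?_⟩
  exact averaging_principle hr hf hqb huc hbd hmean rfl hy.1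
    (fun J' y' hy' => hun.2 _ _ _ _ hy' hy.1) hL hδ
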